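/- **Theorem 5.1.** Let $\gamma>0$ and let $g\in C^\infty(\mathbb R)$ be real-valued with $g(0)=0$, $g(r)\ge\gamma r^2$ for all $r\in\mathbb R$ and $g(r)>\gamma r^2$ for all $r\ne0$. Put $G(x)=\tfrac12e^{-|x|}$, let $(G*f)(x,y)=\int_{\mathbb R}G(x-z)f(z,y)\,dz$, and for $s\ge0$ let $X^s(\mathbb R^2)$ be the space of all $f\in H^s(\mathbb R^2)$ with $\partial_xf\in H^s(\mathbb R^2)$ and $\partial_x^{-1}f\in H^s(\mathbb R^2)$, where $\partial_x^{-1}$ is the Fourier multiplier $(i\xi)^{-1}$, with norm $\|f\|_{X^s}^2=\|f\|_{H^s}^2+\|\partial_x^{-1}f\|_{H^s}^2+\|\partial_xf\|_{H^s}^2$. Let $s\ge2$, $T>0$, and let the real-valued function $$u\in C([0,T];X^s(\mathbb R^2))\cap C^1([0,T];X^{s-2}(\mathbb R^2))$$ be a solution on $[0,T]$ of $$\begin{cases}u_t+\gamma uu_x+G*\partial_x\left(\tfrac12g(u)+\tfrac\gamma2u_x^2-\tfrac\gamma2u^2\right)+G*v_y=0,\\ u_y=v_x,\\ u|_{t=0}=u_0,\end{cases}\qquad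 (x,y)\in\mathbb R^2,$$ where $v(t)\in L^2(\mathbb R^2)$ (that is, $v=\partial_x^{-1}u_y$), the space derivatives are weak derivatives, the first equation is an identity in $L^2(\mathbb R^2)$ for every $t\in[0,T]$, and each $u(t)$ is identified with its continuous representative. If $u$ is non-trivial, i.e. $u(t,x,y)\neq0$ for some $(t,x,y)\in[0,T]\times\mathbb R^2$, then there is no non-empty relatively open set $W\subseteq[0,T]\times\mathbb R$ such that $$u(t,x,y)=0\qquad\text{for all }(t,x)\in W,\ y\in\mathbb R.$$ -/

import Mathlib

open MeasureTheory Filter Topology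
open scoped ENNReal ContDiff FourierTransform

noncomputable section

namespace CHKP

/-- The plane, with coordinates `x = p 0` and `y = p 1`. -/
abbrev Plane : Type := EuclideanSpace ℝ (Fin 2)

open Classical in
/-- The Plancherel Fourier transform of a real-valued square integrable function on the plane
(the value for functions outside `L²` is never used). Mathlib's normalisation is
`∫ exp (-2πi ⟨p, ζ⟩) f p dp`, so the frequencies dual to `(x, y)` are
`(ξ, η) = (2π ζ 0, 2π ζ 1)`. -/
def fourierL2 (f : Plane → ℝ) : Plane → ℂ :=
  if h : MemLp (fun p => (f p : ℂ)) 2 (volume : Measure Plane) then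
    ((𝓕 (h.toLp (fun p => (f p : ℂ))) : Lp ℂ 2 (volume : Measure Plane)) : Plane → ℂ)
  else 0

/-- The frequency `ξ` dual to `x`. -/
def freqX (ζ : Plane) : ℝ := 2 * Real.pi * ζ 0

/-- The frequency `η` dual to `y`. -/
def freqY (ζ : Plane) : ℝ := 2 * Real.pi * ζ 1

/-- The squared `H^s` norm `∫ (1 + |ξ|² + |η|²)^s |h|²` of the function whose Fourier transform
is `h`. -/
def sobolevSq (s : ℝ) (h : Plane → ℂ) : ℝ≥0∞ :=
  ∫⁻ ζ : Plane, ENNReal.ofReal ((1 + freqX ζ ^ 2 + freqY ζ ^ 2) ^ s * ‖h ζ‖ ^ 2)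

/-- The `X^s` norm `(‖f‖²_{H^s} + ‖∂ₓ⁻¹ f‖²_{H^s} + ‖∂ₓ f‖²_{H^s})^{1/2}`, where `∂ₓ` and `∂ₓ⁻¹`
are the Fourier multipliers `iξ` and `(iξ)⁻¹`. -/
def xNorm (s : ℝ) (f : Plane → ℝ) : ℝ≥0∞ :=
  (sobolevSq s (fourierL2 f)
    + sobolevSq s (fun ζ => (Complex.I * (freqX ζ : ℂ))⁻¹ * fourierL2 f ζ)
    + sobolevSq s (fun ζ => (Complex.I * (freqX ζ : ℂ)) * fourierL2 f ζ)) ^ (1 / 2 : ℝ)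

/-- Membership in the space `X^s(ℝ²)`, `s ≥ 0`, of real-valued functions. -/
def MemX (s : ℝ) (f : Plane → ℝ) : Prop :=
  MemLp f 2 (volume : Measure Plane) ∧ xNorm s f < ⊤

/-- `u ∈ C([0,T]; X^s)`. -/
def ContX (s T : ℝ) (u : ℝ → Plane → ℝ) : Prop :=
  (∀ t ∈ Set.Icc 0 T, MemX s (u t)) ∧
  ∀ t ∈ Set.Icc 0 T,
    Tendsto (fun τ => xNorm s (u τ - u t)) (𝓝[Set.Icc 0 T] t) (𝓝 0)

/-- `u` is differentiable from `[0,T]` into `X^s` with derivative `ut`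
(one-sided at the end points). -/
def HasTimeDerivX (s T : ℝ) (u ut : ℝ → Plane → ℝ) : Prop :=
  ∀ t ∈ Set.Icc 0 T,
    Tendsto (fun τ => xNorm s ((τ - t)⁻¹ • (u τ - u t) - ut t))
      (𝓝[Set.Icc 0 T \ {t}] t) (𝓝 0)

/-- `f'` is the weak (distributional) partial derivative of `f` in the `i`-th coordinate. -/
def IsWeakDeriv (i : Fin 2) (f f' : Plane → ℝ) : Prop :=
  LocallyIntegrable f (volume : Measure Plane) ∧
  LocallyIntegrable f' (volume : Measure Plane) ∧
  ∀ φ : Plane → ℝ, ContDiff ℝ ∞ φ → HasCompactSupport φ →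
    ∫ p : Plane, f p * fderiv ℝ φ p (EuclideanSpace.single i (1 : ℝ)) = -∫ p : Plane, f' p * φ p

/-- `G(x) = exp (-|x|) / 2`. -/
def G (x : ℝ) : ℝ := 1 / 2 * Real.exp (-|x|)

/-- `(G * f)(x, y) = ∫ G(x - z) f(z, y) dz`, convolution in the first variable. -/
def convG (f : Plane → ℝ) (p : Plane) : ℝ :=
  ∫ z : ℝ, G (p 0 - z) * f !₂[z, p 1]

/-- `g(u)/2 + γ uₓ²/2 - γ u²/2`. -/
def flux (γ : ℝ) (g : ℝ → ℝ) (u ux : Plane → ℝ) (p : Plane) : ℝ :=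
  1 / 2 * g (u p) + γ / 2 * ux p ^ 2 - γ / 2 * u p ^ 2

/-- The equations `uₜ + γ u uₓ + G * ∂ₓ (g(u)/2 + γ uₓ²/2 - γ u²/2) + G * v_y = 0`, `u_y = vₓ`
at a fixed time, for `v ∈ L²` (so `v = ∂ₓ⁻¹ u_y`); space derivatives are weak derivatives and
the first equation is an identity of `L²` functions. -/
def SystemAt (γ : ℝ) (g : ℝ → ℝ) (u ut v : Plane → ℝ) : Prop :=
  ∃ ux uy vy Fx : Plane → ℝ,
    IsWeakDeriv 0 u ux ∧ IsWeakDeriv 1 u uy ∧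
    MemLp v 2 (volume : Measure Plane) ∧ IsWeakDeriv 0 v uy ∧
    MemLp vy 2 (volume : Measure Plane) ∧ IsWeakDeriv 1 v vy ∧
    MemLp Fx 2 (volume : Measure Plane) ∧ IsWeakDeriv 0 (flux γ g u ux) Fx ∧
    ∀ᵐ p : Plane, ut p + γ * u p * ux p + convG Fx p + convG vy p = 0

/-- `u` is a solution with initial value `u₀` on `[0,T]` in
`C([0,T]; X^s) ∩ C¹([0,T]; X^{s-2})`. For `s ≥ 2` every element of `X^s` has exactly one continuous
representative; `u t` denotes that representative. -/
structure IsSolution (γ : ℝ) (g : ℝ → ℝ) (s T : ℝ) (u₀ : Plane → ℝ) (u : ℝ → Plane → ℝ) :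
    Prop where
  continuous_rep : ∀ t ∈ Set.Icc 0 T, Continuous (u t)
  contX : ContX s T u
  initial : u 0 =ᵐ[volume] u₀
  system : ∃ ut v : ℝ → Plane → ℝ, ContX (s - 2) T ut ∧ HasTimeDerivX (s - 2) T u ut ∧
    ∀ t ∈ Set.Icc 0 T, SystemAt γ g (u t) (ut t) (v t)

end CHKP

end

/-!
A solution of the system with `u (t, x, y) = 0` for all `(t, x)` in an open set `W` and all `y`
vanishes identically, for two reasons.

*A strip of zeros forces the whole time slice to vanish* (`SystemAt.ae_eq_zero_of_strip`). Fix
`(t, x₀) ∈ W`; then `u t` vanishes on a strip `(a, b) × ℝ`, and so do `u_x` and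
`u_t` (`HasTimeDerivX.ae_eq_zero_of_strip`). With the flux
`F = g(u)/2 + γ u_x²/2 - γ u²/2` the first equation therefore says that `G * (F_x + v_y) = 0` on the
strip. Integration in `y` removes `v_y`, so formally `Φ(x) = ∫ F(x, y) dy` satisfies `G * Φ' = 0` on
`(a, b)`. Now `G` is the kernel of `(1 - ∂ₓ²)⁻¹` (`integral_G_mul_sub`). For a profile `h` such that
`h - h''` is supported in `(a, b)` and `h' > 0` outside of this interval (`exists_profile`), this
gives `∫ Φ h' = 0`. The assumption `g(r) ≥ γ r²` makes `F` nonnegative, and `F = 0` on the strip;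
hence `F = 0` everywhere. As `g(r) > γ r²` for `r ≠ 0`, this means `u t = 0`. The integration
in `y` is carried out with the slowly varying cutoffs `cutY n`, whose derivatives tend to `0` under
a square integrable majorant, so that the term with `v` disappears in the limit.

*The energy `∫ u² + u_x²` is conserved* (`SystemAt.integral_energy_eq_zero`,
`IsSolution.ae_eq_zero`), so that a solution which vanishes at one time vanishes at all times. One
tests the equation with `u - u_xx`, which turns `G * (F_x + v_y)` into `F_x + v_y` tested with
`u`. The terms which are total `x`-derivatives vanish, the cubic terms in `u_x` cancel
(`integral_mul_deriv_mul_deriv`), and `∫ v_y u = -∫ v u_y = -∫ v v_x = 0`.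

Since only `u`, `u_x ∈ H²` is available, the calculations need some preparation.
`HasFourierDeriv` describes derivatives of square integrable functions by the symbol of the
Fourier transform; it agrees with weak differentiability
(`IsWeakDeriv.hasFourierDeriv`, `HasFourierDeriv.isWeakDeriv`) and makes integration by parts a
consequence of Parseval's identity. The embedding `H² ⊆ L^∞` shows that `u` and `u_x` are bounded,
and that `u_x` is a classical derivative (`MemX.regularity`). The second derivative `u_xx` is only
square integrable, and identities which contain it are proved for frequency truncations (`lowPass`)
first.
-/

noncomputable section

namespace CHKP

open scoped LineDeriv

/-! ### The `L²` Fourier transform of real functions -/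

theorem MemLp.complex {f : Plane → ℝ} (hf : MemLp f 2 volume) :
    MemLp (fun p => (f p : ℂ)) 2 (volume : Measure Plane) :=
  hf.ofReal

theorem fourierL2_eq {f : Plane → ℝ} (h : MemLp (fun p => (f p : ℂ)) 2 (volume : Measure Plane)) :
    fourierL2 f = ((𝓕 (h.toLp (fun p => (f p : ℂ))) : Lp ℂ 2 (volume : Measure Plane)) :
      Plane → ℂ) := by
  simp only [fourierL2, dif_pos h]

theorem memLp_fourierL2 (f : Plane → ℝ) : MemLp (fourierL2 f) 2 (volume : Measure Plane) := by
  unfold fourierL2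
  split_ifs with h
  · exact Lp.memLp _
  · exact MemLp.zero

theorem toLp_fourierL2 {f : Plane → ℝ}
    (h : MemLp (fun p => (f p : ℂ)) 2 (volume : Measure Plane)) :
    (memLp_fourierL2 f).toLp (fourierL2 f) = 𝓕 (h.toLp (fun p => (f p : ℂ))) := by
  apply Lp.ext
  refine (MemLp.coeFn_toLp _).trans ?_
  rw [fourierL2_eq h]

theorem fourierL2_congr {f k : Plane → ℝ} (h : f =ᵐ[volume] k) : fourierL2 f = fourierL2 k := by
  have hc : (fun p => (f p : ℂ)) =ᵐ[volume] fun p => (k p : ℂ) := by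
    filter_upwards [h] with p hp
    rw [hp]
  unfold fourierL2
  by_cases hf : MemLp (fun p => (f p : ℂ)) 2 (volume : Measure Plane)
  · have hk := (memLp_congr_ae hc).1 hf
    rw [dif_pos hf, dif_pos hk, (MemLp.toLp_eq_toLp_iff hf hk).2 hc]
  · have hk := fun hk => hf ((memLp_congr_ae hc).2 hk)
    rw [dif_neg hf, dif_neg hk]

theorem eLpNorm_fourierL2 {f : Plane → ℝ} (hf : MemLp f 2 volume) :
    eLpNorm (fourierL2 f) 2 volume = eLpNorm f 2 volume := by
  have h := MemLp.complex hf
  have h1 := Lp.norm_fourier_eq (h.toLp (fun p => (f p : ℂ)))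
  rw [← toLp_fourierL2 h, Lp.norm_toLp, Lp.norm_toLp,
    ENNReal.toReal_eq_toReal_iff' (memLp_fourierL2 f).2.ne h.2.ne] at h1
  rw [h1]
  exact eLpNorm_congr_norm_ae (Eventually.of_forall fun p => by simp)

theorem fourierL2_sub {f k : Plane → ℝ} (hf : MemLp f 2 volume) (hk : MemLp k 2 volume) :
    fourierL2 (f - k) =ᵐ[volume] fourierL2 f - fourierL2 k := by
  have hf' := MemLp.complex hf
  have hk' := MemLp.complex hk
  have hs := MemLp.complex (hf.sub hk)
  have : hs.toLp (fun p => (((f - k) p : ℝ) : ℂ)) = hf'.toLp _ - hk'.toLp _ := by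
    rw [← MemLp.toLp_sub]
    congr 1
    ext p
    simp
  rw [fourierL2_eq hs, fourierL2_eq hf', fourierL2_eq hk', this]
  rw [show 𝓕 (hf'.toLp (fun p => (f p : ℂ)) - hk'.toLp (fun p => (k p : ℂ))) =
    𝓕 (hf'.toLp (fun p => (f p : ℂ))) - 𝓕 (hk'.toLp (fun p => (k p : ℂ))) from
    (Lp.fourierTransformₗᵢ Plane ℂ).map_sub _ _]
  exact Lp.coeFn_sub _ _

theorem fourierL2_smul {f : Plane → ℝ} (hf : MemLp f 2 volume) (c : ℝ) :
    fourierL2 (c • f) =ᵐ[volume] (c : ℂ) • fourierL2 f := by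
  have hf' := MemLp.complex hf
  have hs := MemLp.complex (hf.const_smul c)
  have : hs.toLp (fun p => (((c • f) p : ℝ) : ℂ)) = (c : ℂ) • hf'.toLp _ := by
    rw [← MemLp.toLp_const_smul]
    congr 1
    ext p
    simp
  rw [fourierL2_eq hs, fourierL2_eq hf', this, FourierTransform.fourier_smul]
  exact Lp.coeFn_smul _ _

theorem integral_mul_eq_fourierL2 {f k : Plane → ℝ} (hf : MemLp f 2 volume)
    (hk : MemLp k 2 volume) :
    ((∫ p, f p * k p : ℝ) : ℂ) = ∫ ζ, fourierL2 k ζ * starRingEnd ℂ (fourierL2 f ζ) := by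
  have hf' := MemLp.complex hf
  have hk' := MemLp.complex hk
  have h := Lp.inner_fourier_eq (hf'.toLp (fun p => (f p : ℂ))) (hk'.toLp (fun p => (k p : ℂ)))
  rw [← toLp_fourierL2 hf', ← toLp_fourierL2 hk', L2.inner_def, L2.inner_def] at h
  have e1 : ∫ ζ, inner ℂ ((memLp_fourierL2 f).toLp (fourierL2 f) ζ)
      ((memLp_fourierL2 k).toLp (fourierL2 k) ζ) =
      ∫ ζ, fourierL2 k ζ * starRingEnd ℂ (fourierL2 f ζ) := by
    apply integral_congr_ae
    filter_upwards [(memLp_fourierL2 f).coeFn_toLp, (memLp_fourierL2 k).coeFn_toLp] with ζ h1 h2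
    rw [h1, h2, RCLike.inner_apply]
  have e2 : ∫ ζ, inner ℂ (hf'.toLp (fun p => (f p : ℂ)) ζ)
      (hk'.toLp (fun p => (k p : ℂ)) ζ) = ∫ p, ((f p * k p : ℝ) : ℂ) := by
    apply integral_congr_ae
    filter_upwards [hf'.coeFn_toLp, hk'.coeFn_toLp] with ζ h1 h2
    rw [h1, h2, RCLike.inner_apply]
    simp [mul_comm]
  rw [← e1, h, e2, integral_complex_ofReal]

/-! ### Weak derivatives of square integrable functions on the Fourier side -/

/-- The symbol `2πi ζ_i` of the partial derivative in the `i`-th coordinate. -/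
def symb (i : Fin 2) (ζ : Plane) : ℂ := Complex.I * ((2 * Real.pi * ζ i : ℝ) : ℂ)

/-- `f` and `f'` are square integrable and `f'` is the `i`-th partial derivative of `f`, in the
sense that the Fourier transform of `f'` is the symbol times that of `f`. -/
structure HasFourierDeriv (i : Fin 2) (f f' : Plane → ℝ) : Prop where
  memLp : MemLp f 2 (volume : Measure Plane)
  memLp_deriv : MemLp f' 2 (volume : Measure Plane)
  fourier_eq : fourierL2 f' =ᵐ[volume] fun ζ => symb i ζ * fourierL2 f ζ

theorem HasFourierDeriv.congr {i : Fin 2} {f k f' k' : Plane → ℝ} (h : HasFourierDeriv i f f')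
    (hf : f =ᵐ[volume] k) (hf' : f' =ᵐ[volume] k') : HasFourierDeriv i k k' :=
  ⟨(memLp_congr_ae hf).1 h.1, (memLp_congr_ae hf').1 h.2,
    by rw [← fourierL2_congr hf, ← fourierL2_congr hf']; exact h.3⟩

theorem HasFourierDeriv.sub {i : Fin 2} {f k f' k' : Plane → ℝ} (h : HasFourierDeriv i f f')
    (h' : HasFourierDeriv i k k') : HasFourierDeriv i (f - k) (f' - k') := by
  refine ⟨h.1.sub h'.1, h.2.sub h'.2, ?_⟩
  filter_upwards [fourierL2_sub h.1 h'.1, fourierL2_sub h.2 h'.2, h.3, h'.3] with ζ h1 h2 h3 h4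
  rw [h1, h2, Pi.sub_apply, Pi.sub_apply, h3, h4, mul_sub]

theorem HasFourierDeriv.smul {i : Fin 2} {f f' : Plane → ℝ} (h : HasFourierDeriv i f f')
    (c : ℝ) : HasFourierDeriv i (c • f) (c • f') := by
  refine ⟨h.1.const_smul c, h.2.const_smul c, ?_⟩
  filter_upwards [fourierL2_smul h.1 c, fourierL2_smul h.2 c, h.3] with ζ h1 h2 h3
  rw [h1, h2, Pi.smul_apply, Pi.smul_apply, h3, smul_eq_mul, smul_eq_mul]
  ring

/-- Integration by parts, by Parseval's identity and the skew symmetry of the symbol. -/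
theorem HasFourierDeriv.integral_mul {i : Fin 2} {f k f' k' : Plane → ℝ}
    (h : HasFourierDeriv i f f') (h' : HasFourierDeriv i k k') :
    ∫ p, f p * k' p = -∫ p, f' p * k p := by
  apply Complex.ofReal_injective
  push_cast
  rw [integral_mul_eq_fourierL2 h.1 h'.2, integral_mul_eq_fourierL2 h.2 h'.1, ← integral_neg]
  apply integral_congr_ae
  filter_upwards [h.3, h'.3] with ζ h1 h2
  rw [h1, h2]
  simp only [symb, map_mul, Complex.conj_I, Complex.conj_ofReal]
  ring

theorem HasFourierDeriv.integral_mul_self {i : Fin 2} {f f' : Plane → ℝ}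
    (h : HasFourierDeriv i f f') : ∫ p, f' p * f p = 0 := by
  have h1 := h.integral_mul h
  simp_rw [mul_comm (f _)] at h1
  linarith

/-- The symbol relation between the Fourier transforms of `F` and `F'` says that `F'` is the
`i`-th partial derivative of `F` as a tempered distribution. -/
theorem fourier_eq_iff_lineDeriv (i : Fin 2) (F F' : Lp ℂ 2 (volume : Measure Plane)) :
    ((𝓕 F' : Lp ℂ 2 (volume : Measure Plane)) : Plane → ℂ) =ᵐ[volume]
        (fun ζ => symb i ζ * (𝓕 F : Lp ℂ 2 (volume : Measure Plane)) ζ) ↔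
      ∀ φ : SchwartzMap Plane ℂ,
        ∫ p, F p * fderiv ℝ φ p (EuclideanSpace.single i (1 : ℝ)) = -∫ p, F' p * φ p := by
  set m : Plane := EuclideanSpace.single i (1 : ℝ) with hm
  have hgr : (inner ℝ · m : Plane → ℝ).HasTemperateGrowth := by fun_prop
  have hgrC : (fun ζ : Plane => ((inner ℝ ζ m : ℝ) : ℂ)).HasTemperateGrowth := by fun_prop
  have hinner : ∀ ζ : Plane, inner ℝ ζ m = ζ i := fun ζ => by
    simp [hm, EuclideanSpace.inner_single_right]
  have hD : (∀ φ : SchwartzMap Plane ℂ, ∫ p, F p * fderiv ℝ φ p m = -∫ p, F' p * φ p) ↔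
      ∂_{m} (Lp.toTemperedDistribution F) = Lp.toTemperedDistribution F' := by
    rw [UniformConvergenceCLM.ext_iff]
    refine forall_congr' fun φ => ?_
    rw [TemperedDistribution.lineDerivOp_apply_apply, map_neg, Lp.toTemperedDistribution_apply,
      Lp.toTemperedDistribution_apply, neg_eq_iff_eq_neg]
    simp only [SchwartzMap.lineDerivOp_apply_eq_fderiv, smul_eq_mul, mul_comm]
  have hF : ∂_{m} (Lp.toTemperedDistribution F) = Lp.toTemperedDistribution F' ↔
      ∀ φ : SchwartzMap Plane ℂ,
        ∫ ζ, φ ζ • (symb i ζ * (𝓕 F : Lp ℂ 2 (volume : Measure Plane)) ζ) =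
          ∫ ζ, φ ζ • (𝓕 F' : Lp ℂ 2 (volume : Measure Plane)) ζ := by
    rw [← (FourierTransform.fourierEquiv ℂ (TemperedDistribution Plane ℂ)).injective.eq_iff]
    simp only [FourierTransform.fourierEquiv_apply]
    rw [TemperedDistribution.fourier_lineDerivOp_eq, Lp.fourier_toTemperedDistribution_eq,
      Lp.fourier_toTemperedDistribution_eq, UniformConvergenceCLM.ext_iff]
    refine forall_congr' fun φ => ?_
    have e : ((2 * Real.pi * Complex.I) • TemperedDistribution.smulLeftCLM ℂ (inner ℝ · m)
        (Lp.toTemperedDistribution (𝓕 F))) φ =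
        ∫ ζ, φ ζ • (symb i ζ * (𝓕 F : Lp ℂ 2 (volume : Measure Plane)) ζ) := by
      rw [_root_.smul_apply, TemperedDistribution.smulLeftCLM_apply_apply,
        Lp.toTemperedDistribution_apply, smul_eq_mul, ← integral_const_mul]
      congr 1
      ext ζ
      rw [SchwartzMap.smulLeftCLM_apply_apply hgrC, hinner]
      simp only [smul_eq_mul, symb]
      push_cast
      ring
    rw [e, Lp.toTemperedDistribution_apply]
  rw [hD, hF]
  constructor
  · intro h φ
    apply integral_congr_ae
    filter_upwards [h] with ζ hζ
    rw [hζ]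
  · intro h
    refine (ae_eq_of_integral_contDiff_smul_eq ?_ ?_ ?_)
    · exact (Lp.memLp _).locallyIntegrable (by norm_num)
    · have hc : Continuous (symb i) := by
        unfold symb
        fun_prop
      have hl := ((Lp.memLp (𝓕 F)).locallyIntegrable (by norm_num)).locallyIntegrableOn Set.univ
      exact locallyIntegrableOn_univ.1
        (hl.continuousOn_mul hc.continuousOn isOpen_univ.isLocallyClosed)
    · intro g g_smooth g_cpt
      have hg₁ : HasCompactSupport (Complex.ofRealCLM ∘ g) := g_cpt.comp_left rfl
      have hg₂ : ContDiff ℝ ∞ (Complex.ofRealCLM ∘ g) := by fun_prop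
      have := h (hg₁.toSchwartzMap hg₂)
      simpa using this.symm

/-! ### Weak derivatives against test functions that need not have compact support -/

theorem IsWeakDeriv.unique {i : Fin 2} {f k l : Plane → ℝ} (h : IsWeakDeriv i f k)
    (h' : IsWeakDeriv i f l) : k =ᵐ[volume] l := by
  refine ae_eq_of_integral_contDiff_smul_eq h.2.1 h'.2.1 fun φ hφ hφc => ?_
  have h1 := h.2.2 φ hφ hφc
  have h2 := h'.2.2 φ hφ hφc
  simp only [smul_eq_mul, mul_comm (φ _)]
  linarith

theorem IsWeakDeriv.congr {i : Fin 2} {f k f' : Plane → ℝ} (h : IsWeakDeriv i f f')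
    (hfk : f =ᵐ[volume] k) : IsWeakDeriv i k f' := by
  refine ⟨(locallyIntegrable_congr hfk).1 h.1, h.2.1, fun φ hφ hφc => ?_⟩
  rw [← h.2.2 φ hφ hφc]
  apply integral_congr_ae
  filter_upwards [hfk] with p hp
  rw [hp]

/-- Compactly supported smooth cutoffs `χ n` which increase to `1` and whose gradients are
uniformly bounded and tend to `0`. -/
theorem exists_cutoff : ∃ (χ : ℕ → Plane → ℝ) (C : ℝ), (∀ n, ContDiff ℝ ∞ (χ n)) ∧
    (∀ n, HasCompactSupport (χ n)) ∧ (∀ n p, |χ n p| ≤ 1) ∧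
    (∀ p, Tendsto (fun n => χ n p) atTop (𝓝 1)) ∧
    (∀ n p v, |fderiv ℝ (χ n) p v| ≤ C * ‖v‖) ∧
    (∀ p v, Tendsto (fun n => fderiv ℝ (χ n) p v) atTop (𝓝 0)) := by
  let ρ : ContDiffBump (0 : Plane) := ⟨1, 2, one_pos, one_lt_two⟩
  have hρ : ContDiff ℝ ∞ ρ := ρ.contDiff
  have hρc : HasCompactSupport ρ := ρ.hasCompactSupport
  obtain ⟨C, hC⟩ := (hρc.fderiv (𝕜 := ℝ)).exists_bound_of_continuous
    (hρ.continuous_fderiv (by simp))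
  have hC0 : 0 ≤ C := (norm_nonneg _).trans (hC 0)
  have hpos : ∀ n : ℕ, (0 : ℝ) < ((n : ℝ) + 1)⁻¹ := fun n => by positivity
  have hd : ∀ (n : ℕ) (p v : Plane), fderiv ℝ (fun p => ρ (((n : ℝ) + 1)⁻¹ • p)) p v =
      ((n : ℝ) + 1)⁻¹ * fderiv ℝ ρ (((n : ℝ) + 1)⁻¹ • p) v := by
    intro n p v
    have h1 : HasFDerivAt (fun p : Plane => ((n : ℝ) + 1)⁻¹ • p)
        (((n : ℝ) + 1)⁻¹ • ContinuousLinearMap.id ℝ Plane) p :=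
      (((n : ℝ) + 1)⁻¹ • ContinuousLinearMap.id ℝ Plane).hasFDerivAt
    have h2 := ((hρ.differentiable (by simp) (((n : ℝ) + 1)⁻¹ • p)).hasFDerivAt).comp p h1
    rw [show (fun p => ρ (((n : ℝ) + 1)⁻¹ • p)) = ρ ∘ fun p : Plane => ((n : ℝ) + 1)⁻¹ • p from rfl,
      h2.fderiv]
    simp
  have hb : ∀ (n : ℕ) (p v : Plane), |fderiv ℝ (fun p => ρ (((n : ℝ) + 1)⁻¹ • p)) p v| ≤
      ((n : ℝ) + 1)⁻¹ * (C * ‖v‖) := by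
    intro n p v
    rw [hd, abs_mul, abs_of_pos (hpos n)]
    refine mul_le_mul_of_nonneg_left ?_ (hpos n).le
    exact ((fderiv ℝ ρ _).le_opNorm v).trans (mul_le_mul_of_nonneg_right (hC _) (norm_nonneg _))
  refine ⟨fun n p => ρ (((n : ℝ) + 1)⁻¹ • p), C, fun n => ?_, fun n => ?_, fun n p => ?_,
    fun p => ?_, fun n p v => ?_, fun p v => ?_⟩
  · exact hρ.comp (contDiff_const_smul _)
  · exact hρc.comp_smul (hpos n).ne'
  · rw [abs_of_nonneg ρ.nonneg]
    exact ρ.le_one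
  · have h0 : Tendsto (fun n : ℕ => ((n : ℝ) + 1)⁻¹ • p) atTop (𝓝 ((0 : ℝ) • p)) :=
      (tendsto_inv_atTop_zero.comp
        (tendsto_atTop_add_const_right _ _ tendsto_natCast_atTop_atTop)).smul_const p
    have h1 := (hρ.continuous.tendsto ((0 : ℝ) • p)).comp h0
    have h2 : ρ ((0 : ℝ) • p) = 1 := by
      apply ρ.one_of_mem_closedBall
      simp [ρ]
    rwa [h2] at h1
  · refine (hb n p v).trans ?_
    have : ((n : ℝ) + 1)⁻¹ ≤ 1 := inv_le_one_of_one_le₀ (by linarith [n.cast_nonneg (α := ℝ)])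
    exact mul_le_of_le_one_left (by positivity) this
  · have h0 : Tendsto (fun n : ℕ => ((n : ℝ) + 1)⁻¹ * (C * ‖v‖)) atTop (𝓝 (0 * (C * ‖v‖))) :=
      (tendsto_inv_atTop_zero.comp
        (tendsto_atTop_add_const_right _ _ tendsto_natCast_atTop_atTop)).mul_const _
    rw [zero_mul] at h0
    exact squeeze_zero_norm (fun n => hb n p v) h0

theorem integrable_mul_of_memLp {f k : Plane → ℝ} (hf : MemLp f 2 volume)
    (hk : MemLp k 2 volume) : Integrable (fun p => f p * k p) volume :=
  hf.integrable_mul hk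

/-- The defining identity of a weak derivative extends from compactly supported to square integrable
smooth test functions, if the functions involved are square integrable. -/
theorem IsWeakDeriv.integral_mul_of_memLp {i : Fin 2} {f f' φ : Plane → ℝ}
    (h : IsWeakDeriv i f f') (hf : MemLp f 2 volume) (hf' : MemLp f' 2 volume)
    (hφ : ContDiff ℝ ∞ φ) (hφ2 : MemLp φ 2 volume)
    (hφ' : MemLp (fun p => fderiv ℝ φ p (EuclideanSpace.single i (1 : ℝ))) 2 volume) :
    ∫ p, f p * fderiv ℝ φ p (EuclideanSpace.single i (1 : ℝ)) = -∫ p, f' p * φ p := by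
  obtain ⟨χ, C, hχ, hχc, hχ1, hχt, hχb, hχ0⟩ := exists_cutoff
  set m : Plane := EuclideanSpace.single i (1 : ℝ) with hm
  have hmn : ‖m‖ = 1 := by simp [hm]
  have hdiff : ∀ n, Differentiable ℝ (χ n) := fun n => (hχ n).differentiable (by simp)
  have hφd : Differentiable ℝ φ := hφ.differentiable (by simp)
  have hχm : ∀ n, Continuous (fun p => fderiv ℝ (χ n) p m) := fun n =>
    ((hχ n).continuous_fderiv (by simp)).clm_apply continuous_const
  have i1 := integrable_mul_of_memLp hf hφ'
  have i2 := integrable_mul_of_memLp hf hφ2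
  have i3 := integrable_mul_of_memLp hf' hφ2
  have e : ∀ n, ∫ p, (χ n p * (f p * fderiv ℝ φ p m) + fderiv ℝ (χ n) p m * (f p * φ p)) =
      -∫ p, χ n p * (f' p * φ p) := by
    intro n
    have := h.2.2 (fun p => χ n p * φ p) ((hχ n).mul hφ) ((hχc n).mul_right)
    rw [show (∫ p, χ n p * (f' p * φ p)) = ∫ p, f' p * (χ n p * φ p) by
      congr 1; ext p; ring, ← this]
    congr 1
    ext p
    rw [fderiv_fun_mul (hdiff n p) (hφd p)]
    simp only [add_apply, smul_apply, smul_eq_mul, ← hm]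
    ring
  have t1 : Tendsto (fun n => ∫ p, (χ n p * (f p * fderiv ℝ φ p m) +
      fderiv ℝ (χ n) p m * (f p * φ p))) atTop (𝓝 (∫ p, f p * fderiv ℝ φ p m)) := by
    refine tendsto_integral_of_dominated_convergence
      (fun p => |f p * fderiv ℝ φ p m| + C * |f p * φ p|) (fun n => ?_)
      (i1.abs.add (i2.abs.const_mul C)) (fun n => Eventually.of_forall fun p => ?_)
      (Eventually.of_forall fun p => ?_)
    · exact ((hχ n).continuous.aestronglyMeasurable.mul i1.1).add
        ((hχm n).aestronglyMeasurable.mul i2.1)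
    · refine (norm_add_le _ _).trans (add_le_add ?_ ?_)
      · rw [Real.norm_eq_abs, abs_mul]
        exact mul_le_of_le_one_left (abs_nonneg _) (hχ1 n p)
      · rw [Real.norm_eq_abs, abs_mul]
        refine mul_le_mul_of_nonneg_right ?_ (abs_nonneg _)
        simpa [hmn] using hχb n p m
    · simpa using ((hχt p).mul_const (f p * fderiv ℝ φ p m)).add
        ((hχ0 p m).mul_const (f p * φ p))
  have t2 : Tendsto (fun n => -∫ p, χ n p * (f' p * φ p)) atTop (𝓝 (-∫ p, f' p * φ p)) := by
    refine (tendsto_integral_of_dominated_convergence (fun p => |f' p * φ p|) (fun n => ?_)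
      i3.abs (fun n => Eventually.of_forall fun p => ?_) (Eventually.of_forall fun p => ?_)).neg
    · exact (hχ n).continuous.aestronglyMeasurable.mul i3.1
    · rw [Real.norm_eq_abs, abs_mul]
      exact mul_le_of_le_one_left (abs_nonneg _) (hχ1 n p)
    · simpa using (hχt p).mul_const (f' p * φ p)
  simp_rw [e] at t1
  exact tendsto_nhds_unique t1 t2

/-! ### Weak derivatives and the symbol -/

theorem hasFourierDeriv_iff_schwartz {i : Fin 2} {f f' : Plane → ℝ} (hf : MemLp f 2 volume)
    (hf' : MemLp f' 2 volume) : HasFourierDeriv i f f' ↔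
      ∀ φ : SchwartzMap Plane ℂ,
        ∫ p, (f p : ℂ) * fderiv ℝ φ p (EuclideanSpace.single i (1 : ℝ)) =
          -∫ p, (f' p : ℂ) * φ p := by
  have hF := MemLp.complex hf
  have hF' := MemLp.complex hf'
  have key := fourier_eq_iff_lineDeriv i (hF.toLp (fun p => (f p : ℂ)))
    (hF'.toLp (fun p => (f' p : ℂ)))
  rw [← fourierL2_eq hF, ← fourierL2_eq hF'] at key
  have e1 : ∀ k : Plane → ℂ, ∫ p, hF.toLp (fun p => (f p : ℂ)) p * k p = ∫ p, (f p : ℂ) * k p :=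
    fun k => integral_congr_ae (by filter_upwards [hF.coeFn_toLp] with p hp; rw [hp])
  have e2 : ∀ k : Plane → ℂ, ∫ p, hF'.toLp (fun p => (f' p : ℂ)) p * k p =
      ∫ p, (f' p : ℂ) * k p :=
    fun k => integral_congr_ae (by filter_upwards [hF'.coeFn_toLp] with p hp; rw [hp])
  simp only [e1, e2] at key
  rw [← key]
  exact ⟨fun h => h.3, fun h => ⟨hf, hf', h⟩⟩

theorem IsWeakDeriv.hasFourierDeriv {i : Fin 2} {f f' : Plane → ℝ} (h : IsWeakDeriv i f f')
    (hf : MemLp f 2 volume) (hf' : MemLp f' 2 volume) : HasFourierDeriv i f f' := by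
  rw [hasFourierDeriv_iff_schwartz hf hf']
  intro φ
  set m : Plane := EuclideanSpace.single i (1 : ℝ) with hm
  have hdφ : MemLp (fun p => fderiv ℝ φ p m) 2 (volume : Measure Plane) := by
    rw [show (fun p => fderiv ℝ φ p m) = ⇑(∂_{m} φ : SchwartzMap Plane ℂ) from
      funext fun p => (SchwartzMap.lineDerivOp_apply_eq_fderiv m φ p).symm]
    exact (∂_{m} φ : SchwartzMap Plane ℂ).memLp 2
  have i1 : Integrable (fun p => (f p : ℂ) * fderiv ℝ φ p m) volume :=
    (MemLp.complex hf).integrable_mul hdφ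
  have i2 : Integrable (fun p => (f' p : ℂ) * φ p) volume :=
    (MemLp.complex hf').integrable_mul (φ.memLp 2)
  have key : ∀ L : ℂ →L[ℝ] ℝ, (∀ (r : ℝ) (z : ℂ), L (r * z) = r * L z) →
      L (∫ p, (f p : ℂ) * fderiv ℝ φ p m) = L (-∫ p, (f' p : ℂ) * φ p) := by
    intro L hL
    have hd : ∀ p, fderiv ℝ (fun p => L (φ p)) p m = L (fderiv ℝ φ p m) := by
      intro p
      have := (L.hasFDerivAt.comp p (φ.differentiableAt (x := p)).hasFDerivAt).fderiv
      rw [show (fun p => L (φ p)) = L ∘ φ from rfl, this]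
      rfl
    have := h.integral_mul_of_memLp hf hf' (φ := fun p => L (φ p))
      (L.contDiff.comp (φ.smooth ⊤)) ((φ.memLp 2).continuousLinearMap_comp L)
      (by simp only [← hm, hd]; exact hdφ.continuousLinearMap_comp L)
    rw [map_neg, ← L.integral_comp_comm i1, ← L.integral_comp_comm i2]
    simp only [hL]
    simpa only [← hm, hd] using this
  apply Complex.ext
  · exact key Complex.reCLM (fun r z => by simp)
  · exact key Complex.imCLM (fun r z => by simp)

theorem isWeakDeriv_of_schwartz {i : Fin 2} {f : Plane → ℝ} {k : Plane → ℂ}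
    (hf : MemLp f 2 volume) (hk : MemLp k 2 volume)
    (h : ∀ φ : SchwartzMap Plane ℂ,
      ∫ p, (f p : ℂ) * fderiv ℝ φ p (EuclideanSpace.single i (1 : ℝ)) = -∫ p, k p * φ p) :
    IsWeakDeriv i f (fun p => (k p).re) := by
  refine ⟨hf.locallyIntegrable (by norm_num), hk.re.locallyIntegrable (by norm_num),
    fun φ hφ hφc => ?_⟩
  have hφ' : HasCompactSupport (Complex.ofRealCLM ∘ φ) := hφc.comp_left rfl
  have hφ'' : ContDiff ℝ ∞ (Complex.ofRealCLM ∘ φ) := by fun_prop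
  have h1 := congrArg Complex.re (h (hφ'.toSchwartzMap hφ''))
  have hd : ∀ p v, fderiv ℝ (Complex.ofRealCLM ∘ φ) p v = (fderiv ℝ φ p v : ℂ) := by
    intro p v
    have := (Complex.ofRealCLM.hasFDerivAt.comp p
      (hφ.differentiable (by simp) p).hasFDerivAt).fderiv
    rw [this]
    rfl
  have i2 : Integrable (fun p => k p * hφ'.toSchwartzMap hφ'' p) volume :=
    hk.integrable_mul ((hφ'.toSchwartzMap hφ'').memLp 2)
  have e1 : (∫ p, k p * hφ'.toSchwartzMap hφ'' p).re = ∫ p, (k p).re * φ p := by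
    change Complex.reCLM _ = _
    rw [← Complex.reCLM.integral_comp_comm i2]
    congr 1
    ext p
    simp
  have e2 : ∫ p, (f p : ℂ) * fderiv ℝ (hφ'.toSchwartzMap hφ'') p
      (EuclideanSpace.single i (1 : ℝ)) =
      ((∫ p, f p * fderiv ℝ φ p (EuclideanSpace.single i (1 : ℝ)) : ℝ) : ℂ) := by
    rw [← integral_complex_ofReal]
    congr 1
    ext p
    push_cast
    rw [← hd]
    rfl
  rw [e2, Complex.neg_re, e1, Complex.ofReal_re] at h1
  exact h1

theorem HasFourierDeriv.isWeakDeriv {i : Fin 2} {f f' : Plane → ℝ} (h : HasFourierDeriv i f f') :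
    IsWeakDeriv i f f' := by
  simpa using isWeakDeriv_of_schwartz h.1 (MemLp.complex h.2)
    ((hasFourierDeriv_iff_schwartz h.1 h.2).1 h)

/-- The derivative given by the symbol is the only weak derivative. -/
theorem HasFourierDeriv.ae_eq {i : Fin 2} {f f' k : Plane → ℝ} (h : HasFourierDeriv i f f')
    (hk : IsWeakDeriv i f k) : k =ᵐ[volume] f' :=
  hk.unique h.isWeakDeriv

/-- If the symbol times the Fourier transform of `f` is square integrable, then `f` has a square
integrable derivative. The inverse Fourier transform provides a complex-valued one; its real part
serves, because `f` is real. -/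
theorem exists_hasFourierDeriv {i : Fin 2} {f : Plane → ℝ} (hf : MemLp f 2 volume)
    (h : MemLp (fun ζ => symb i ζ * fourierL2 f ζ) 2 volume) : ∃ f', HasFourierDeriv i f f' := by
  have hF := MemLp.complex hf
  set k : Lp ℂ 2 (volume : Measure Plane) := 𝓕⁻ (h.toLp _) with hk
  have h1 : (𝓕 k : Lp ℂ 2 (volume : Measure Plane)) = h.toLp _ :=
    FourierTransform.fourier_fourierInv_eq _
  have h2 := (fourier_eq_iff_lineDeriv i (hF.toLp (fun p => (f p : ℂ))) k).1 (by
    rw [h1, ← fourierL2_eq hF]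
    exact h.coeFn_toLp)
  have h3 := isWeakDeriv_of_schwartz (i := i) hf (Lp.memLp k) (fun φ => by
    rw [← h2 φ]
    refine integral_congr_ae ?_
    filter_upwards [hF.coeFn_toLp] with p hp
    rw [hp])
  exact ⟨_, h3.hasFourierDeriv hf (Lp.memLp k).re⟩

/-! ### Inverse Fourier transforms of integrable functions -/

theorem continuous_fourierInv {h : Plane → ℂ} (hh : Integrable h volume) : Continuous (𝓕⁻ h) :=
  VectorFourier.fourierIntegral_continuous Real.continuous_fourierChar
    (L := -innerₗ Plane) (by
      change Continuous fun p : Plane × Plane => -inner ℝ p.1 p.2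
      fun_prop) hh

theorem norm_fourierInv_le (h : Plane → ℂ) (p : Plane) : ‖𝓕⁻ h p‖ ≤ ∫ ζ, ‖h ζ‖ :=
  VectorFourier.norm_fourierIntegral_le_integral_norm _ _ _ _ _

theorem continuous_symb (i : Fin 2) : Continuous (symb i) := by
  unfold symb
  fun_prop

/-- Differentiation in `x` under the integral sign. Only `symb 0 * h`, and not `‖ζ‖ h`, has to be
integrable; the derivative in `y` need not exist. -/
theorem hasDerivAt_fourierInv {h : Plane → ℂ} (hh : Integrable h volume)
    (hh' : Integrable (fun ζ => symb 0 ζ * h ζ) volume) (x y : ℝ) :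
    HasDerivAt (fun x : ℝ => 𝓕⁻ h !₂[x, y]) (𝓕⁻ (fun ζ => symb 0 ζ * h ζ) !₂[x, y]) x := by
  have e : ∀ (k : Plane → ℂ) (x : ℝ), 𝓕⁻ k !₂[x, y] =
      ∫ ζ : Plane, Complex.exp (symb 0 ζ * x + symb 1 ζ * y) * k ζ := by
    intro k x
    rw [Real.fourierInv_eq']
    congr 1
    ext ζ
    rw [smul_eq_mul]
    congr 2
    simp only [symb, PiLp.inner_apply, Fin.sum_univ_two, RCLike.inner_apply, conj_trivial]
    simp
    ring
  have hn : ∀ (x : ℝ) (ζ : Plane), ‖Complex.exp (symb 0 ζ * x + symb 1 ζ * y)‖ = 1 := by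
    intro x ζ
    rw [Complex.norm_exp]
    simp [symb]
  have hc : ∀ x : ℝ, Continuous fun ζ : Plane => Complex.exp (symb 0 ζ * x + symb 1 ζ * y) := by
    intro x
    have := continuous_symb 0
    have := continuous_symb 1
    fun_prop
  simp only [e]
  refine (hasDerivAt_integral_of_dominated_loc_of_deriv_le
    (F' := fun (x : ℝ) (ζ : Plane) =>
      Complex.exp (symb 0 ζ * x + symb 1 ζ * y) * (symb 0 ζ * h ζ))
    (bound := fun ζ => ‖symb 0 ζ * h ζ‖) (s := Set.univ) univ_mem
    (Eventually.of_forall fun x => (hc x).aestronglyMeasurable.mul hh.1) ?_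
    ((hc x).aestronglyMeasurable.mul hh'.1) ?_ hh'.norm ?_).2
  · refine hh.norm.mono' ((hc x).aestronglyMeasurable.mul hh.1) (Eventually.of_forall fun ζ => ?_)
    rw [Pi.mul_apply, norm_mul, hn, one_mul]
  · refine Eventually.of_forall fun ζ x _ => ?_
    rw [norm_mul, hn, one_mul]
  · refine Eventually.of_forall fun ζ x _ => ?_
    have h1 : HasDerivAt (fun x : ℝ => symb 0 ζ * (x : ℂ) + symb 1 ζ * y) (symb 0 ζ) x := by
      simpa using ((Complex.ofRealCLM.hasDerivAt (x := x)).const_mul (symb 0 ζ)).add_const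
        (symb 1 ζ * y)
    have h2 := (h1.cexp).mul_const (h ζ)
    exact h2.congr_deriv (mul_assoc _ _ _)

/-- On `L¹ ∩ L²` the inverse Fourier integral is the inverse Plancherel transform. -/
theorem fourierInv_ae_eq {h : Plane → ℂ} (hh : Integrable h volume) (hh2 : MemLp h 2 volume) :
    𝓕⁻ h =ᵐ[volume] ((𝓕⁻ (hh2.toLp h) : Lp ℂ 2 (volume : Measure Plane)) : Plane → ℂ) := by
  refine ae_eq_of_integral_contDiff_smul_eq (continuous_fourierInv hh).locallyIntegrable
    ((Lp.memLp _).locallyIntegrable (by norm_num)) fun g hg hgc => ?_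
  have hg₁ : HasCompactSupport (Complex.ofRealCLM ∘ g) := hgc.comp_left rfl
  have hg₂ : ContDiff ℝ ∞ (Complex.ofRealCLM ∘ g) := by fun_prop
  set φ := hg₁.toSchwartzMap hg₂ with hφ
  have hφg : ∀ p, φ p = (g p : ℂ) := fun p => rfl
  have h1 : (Lp.toTemperedDistribution (𝓕⁻ (hh2.toLp h))) φ =
      Lp.toTemperedDistribution (hh2.toLp h) (𝓕⁻ φ) := by
    rw [← Lp.fourierInv_toTemperedDistribution_eq]
    rfl
  rw [Lp.toTemperedDistribution_apply, Lp.toTemperedDistribution_apply] at h1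
  have h2 : ∫ ζ, (𝓕⁻ φ) ζ • (hh2.toLp h) ζ = ∫ ζ, 𝓕⁻ (φ : Plane → ℂ) ζ • h ζ := by
    rw [SchwartzMap.fourierInv_coe]
    apply integral_congr_ae
    filter_upwards [hh2.coeFn_toLp] with ζ hζ
    rw [hζ]
  have h3 : ∫ ζ, 𝓕⁻ (φ : Plane → ℂ) ζ • h ζ = ∫ p, φ p • 𝓕⁻ h p := by
    have := VectorFourier.integral_fourierIntegral_smul_eq_flip (μ := (volume : Measure Plane))
      (ν := (volume : Measure Plane)) (e := Real.fourierChar) (L := -innerₗ Plane)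
      (f := (φ : Plane → ℂ)) (g := h) Real.continuous_fourierChar (by
        change Continuous fun p : Plane × Plane => -inner ℝ p.1 p.2
        fun_prop) φ.integrable hh
    rw [show (-innerₗ Plane).flip = -innerₗ Plane by
      ext a b
      change -inner ℝ b a = -inner ℝ a b
      rw [real_inner_comm]] at this
    exact this
  simp only [hφg] at h1 h3
  rw [h2, h3] at h1
  simpa using h1.symm

theorem ae_eq_fourierInv_fourierL2 {f : Plane → ℝ} (hf : MemLp f 2 volume)
    (hi : Integrable (fourierL2 f) volume) : (fun p => (f p : ℂ)) =ᵐ[volume] 𝓕⁻ (fourierL2 f) := by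
  refine EventuallyEq.trans ?_ (fourierInv_ae_eq hi (memLp_fourierL2 f)).symm
  rw [toLp_fourierL2 (MemLp.complex hf), FourierTransform.fourierInv_fourier_eq]
  exact (MemLp.complex hf).coeFn_toLp.symm

/-! ### Frequency truncation -/

/-- The part of `f` with frequencies in the ball of radius `n`. -/
def lowPass (n : ℕ) (f : Plane → ℝ) (p : Plane) : ℝ :=
  (𝓕⁻ ((Metric.closedBall (0 : Plane) n).indicator (fourierL2 f)) p).re

theorem integrable_indicator_fourierL2 (n : ℕ) (f : Plane → ℝ) :
    Integrable ((Metric.closedBall (0 : Plane) n).indicator (fourierL2 f)) volume := by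
  rw [integrable_indicator_iff Metric.isClosed_closedBall.measurableSet]
  have : IsFiniteMeasure (volume.restrict (Metric.closedBall (0 : Plane) n)) :=
    ⟨by simpa using measure_closedBall_lt_top (μ := (volume : Measure Plane)) (x := 0) (r := n)⟩
  exact ((memLp_fourierL2 f).restrict _).integrable (by norm_num)

theorem memLp_indicator_fourierL2 (n : ℕ) (f : Plane → ℝ) :
    MemLp ((Metric.closedBall (0 : Plane) n).indicator (fourierL2 f)) 2 volume :=
  (memLp_fourierL2 f).indicator Metric.isClosed_closedBall.measurableSet

theorem continuous_lowPass (n : ℕ) (f : Plane → ℝ) : Continuous (lowPass n f) :=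
  Complex.continuous_re.comp (continuous_fourierInv (integrable_indicator_fourierL2 n f))

theorem exists_abs_lowPass_le (n : ℕ) (f : Plane → ℝ) : ∃ C, ∀ p, |lowPass n f p| ≤ C :=
  ⟨_, fun p => (Complex.abs_re_le_norm _).trans (norm_fourierInv_le _ p)⟩

theorem memLp_lowPass (n : ℕ) (f : Plane → ℝ) : MemLp (lowPass n f) 2 volume :=
  ((memLp_congr_ae (fourierInv_ae_eq (integrable_indicator_fourierL2 n f)
    (memLp_indicator_fourierL2 n f))).2 (Lp.memLp _)).re

theorem HasFourierDeriv.hasDerivAt_lowPass {f f' : Plane → ℝ} (h : HasFourierDeriv 0 f f')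
    (n : ℕ) (x y : ℝ) :
    HasDerivAt (fun x : ℝ => lowPass n f !₂[x, y]) (lowPass n f' !₂[x, y]) x := by
  have e : (fun ζ => symb 0 ζ * (Metric.closedBall (0 : Plane) n).indicator (fourierL2 f) ζ)
      =ᵐ[volume] (Metric.closedBall (0 : Plane) n).indicator (fourierL2 f') := by
    filter_upwards [h.3] with ζ hζ
    by_cases hm : ζ ∈ Metric.closedBall (0 : Plane) n
    · rw [Set.indicator_of_mem hm, Set.indicator_of_mem hm, hζ]
    · rw [Set.indicator_of_notMem hm, Set.indicator_of_notMem hm, mul_zero]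
  have h1 := hasDerivAt_fourierInv (integrable_indicator_fourierL2 n f)
    ((integrable_indicator_fourierL2 n f').congr e.symm) x y
  have e2 : 𝓕⁻ (fun ζ => symb 0 ζ * (Metric.closedBall (0 : Plane) n).indicator (fourierL2 f) ζ)
      = 𝓕⁻ ((Metric.closedBall (0 : Plane) n).indicator (fourierL2 f')) := by
    ext p
    rw [Real.fourierInv_eq', Real.fourierInv_eq']
    apply integral_congr_ae
    filter_upwards [e] with ζ hζ
    rw [hζ]
  rw [e2] at h1
  exact Complex.reCLM.hasFDerivAt.comp_hasDerivAt x h1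

theorem tendsto_lowPass {f : Plane → ℝ} (hf : MemLp f 2 volume) :
    Tendsto (fun n => eLpNorm (lowPass n f - f) 2 volume) atTop (𝓝 0) := by
  set h : ℕ → Plane → ℂ := fun n => (Metric.closedBall (0 : Plane) n).indicator (fourierL2 f)
    with hh
  have hF := MemLp.complex hf
  -- Plancherel's identity; taking the real part does not increase the distance to the real `f`.
  have h1 : ∀ n, eLpNorm (lowPass n f - f) 2 volume ≤ eLpNorm (h n - fourierL2 f) 2 volume := by
    intro n
    have hi : ((𝓕⁻ ((memLp_indicator_fourierL2 n f).toLp _) :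
        Lp ℂ 2 (volume : Measure Plane)) : Plane → ℂ) =ᵐ[volume] 𝓕⁻ (h n) :=
      (fourierInv_ae_eq (integrable_indicator_fourierL2 n f) (memLp_indicator_fourierL2 n f)).symm
    have e1 : ‖𝓕⁻ ((memLp_indicator_fourierL2 n f).toLp _) - hF.toLp (fun p => (f p : ℂ))‖ =
        ‖(memLp_indicator_fourierL2 n f).toLp _ - (memLp_fourierL2 f).toLp _‖ := by
      rw [toLp_fourierL2 hF, ← (Lp.fourierTransformₗᵢ Plane ℂ).symm.norm_map
        (_ - 𝓕 (hF.toLp (fun p => (f p : ℂ)))), map_sub]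
      congr 2
      exact ((Lp.fourierTransformₗᵢ Plane ℂ).symm_apply_apply _).symm
    rw [← MemLp.toLp_sub, Lp.norm_toLp, Lp.norm_def,
      ENNReal.toReal_eq_toReal_iff' (Lp.memLp _).2.ne
        ((memLp_indicator_fourierL2 n f).sub (memLp_fourierL2 f)).2.ne] at e1
    rw [hh, ← e1]
    refine eLpNorm_mono_ae ?_
    filter_upwards [Lp.coeFn_sub (𝓕⁻ ((memLp_indicator_fourierL2 n f).toLp _))
      (hF.toLp (fun p => (f p : ℂ))), hi, hF.coeFn_toLp] with p hp1 hp2 hp3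
    rw [hp1, Pi.sub_apply, Pi.sub_apply, hp2, hp3]
    have : lowPass n f p - f p = (𝓕⁻ (h n) p - (f p : ℂ)).re := by
      simp [lowPass, hh]
    rw [this]
    exact Complex.abs_re_le_norm _
  refine tendsto_of_tendsto_of_tendsto_of_le_of_le tendsto_const_nhds ?_ (fun n => zero_le) h1
  have h2 : Tendsto (fun n => ∫⁻ ζ, ‖(h n - fourierL2 f) ζ‖ₑ ^ (2 : ℝ)) atTop (𝓝 0) := by
    have hlim : ∫⁻ ζ : Plane, (0 : ℝ≥0∞) = 0 := by simp
    rw [← hlim]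
    refine tendsto_lintegral_of_dominated_convergence' (fun ζ => ‖fourierL2 f ζ‖ₑ ^ (2 : ℝ))
      (fun n => ?_) (fun n => Eventually.of_forall fun ζ => ?_) ?_
      (Eventually.of_forall fun ζ => ?_)
    · exact (((memLp_indicator_fourierL2 n f).sub (memLp_fourierL2 f)).1.enorm.pow_const _)
    · by_cases hm : ζ ∈ Metric.closedBall (0 : Plane) n
      · simp [hh, Set.indicator_of_mem hm]
      · simp [hh, Set.indicator_of_notMem hm]
    · have := lintegral_rpow_enorm_lt_top_of_eLpNorm_lt_top (p := 2) (by norm_num) (by norm_num)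
        (memLp_fourierL2 f).2
      simpa using this.ne
    · refine tendsto_const_nhds.congr' ?_
      obtain ⟨N, hN⟩ := exists_nat_ge ‖ζ‖
      filter_upwards [eventually_ge_atTop N] with n hn
      have hm : ζ ∈ Metric.closedBall (0 : Plane) n := by
        rw [mem_closedBall_zero_iff]
        exact hN.trans (by exact_mod_cast hn)
      simp [hh, Set.indicator_of_mem hm]
  have h3 := h2.ennrpow_const (1 / 2)
  simpa [eLpNorm_eq_lintegral_rpow_enorm_toReal] using h3

/-! ### Limits of integrals of products -/

theorem inner_toLp {f k : Plane → ℝ} (hf : MemLp f 2 volume) (hk : MemLp k 2 volume) :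
    inner ℝ (hf.toLp f) (hk.toLp k) = ∫ p, f p * k p := by
  rw [L2.inner_def]
  apply integral_congr_ae
  filter_upwards [hf.coeFn_toLp, hk.coeFn_toLp] with p h1 h2
  rw [h1, h2, RCLike.inner_apply, conj_trivial, mul_comm]

theorem tendsto_integral_mul {f k : ℕ → Plane → ℝ} {f₀ k₀ : Plane → ℝ}
    (hf : ∀ n, MemLp (f n) 2 volume) (hk : ∀ n, MemLp (k n) 2 volume)
    (hf₀ : MemLp f₀ 2 volume) (hk₀ : MemLp k₀ 2 volume)
    (h : Tendsto (fun n => eLpNorm (f n - f₀) 2 volume) atTop (𝓝 0))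
    (h' : Tendsto (fun n => eLpNorm (k n - k₀) 2 volume) atTop (𝓝 0)) :
    Tendsto (fun n => ∫ p, f n p * k n p) atTop (𝓝 (∫ p, f₀ p * k₀ p)) := by
  have := ((Lp.tendsto_Lp_iff_tendsto_eLpNorm'' f hf f₀ hf₀).2 h).inner (𝕜 := ℝ)
    ((Lp.tendsto_Lp_iff_tendsto_eLpNorm'' k hk k₀ hk₀).2 h')
  simpa only [inner_toLp] using this

theorem memLp_bounded_mul {w f : Plane → ℝ} {M : ℝ} (hw : AEStronglyMeasurable w volume)
    (hM : ∀ p, |w p| ≤ M) (hf : MemLp f 2 volume) : MemLp (fun p => w p * f p) 2 volume := by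
  refine MemLp.of_le_mul (c := M) hf (hw.mul hf.1) (Eventually.of_forall fun p => ?_)
  rw [norm_mul]
  exact mul_le_mul_of_nonneg_right (hM p) (norm_nonneg _)

theorem tendsto_eLpNorm_bounded_mul {w : Plane → ℝ} {f : ℕ → Plane → ℝ} {f₀ : Plane → ℝ} {M : ℝ}
    (hM : ∀ p, |w p| ≤ M)
    (h : Tendsto (fun n => eLpNorm (f n - f₀) 2 volume) atTop (𝓝 0)) :
    Tendsto (fun n => eLpNorm ((fun p => w p * f n p) - fun p => w p * f₀ p) 2 volume) atTop
      (𝓝 0) := by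
  have h0 : Tendsto (fun n => ENNReal.ofReal M * eLpNorm (f n - f₀) 2 volume) atTop
      (𝓝 (ENNReal.ofReal M * 0)) := ENNReal.Tendsto.const_mul h (Or.inr ENNReal.ofReal_ne_top)
  rw [mul_zero] at h0
  refine tendsto_of_tendsto_of_tendsto_of_le_of_le tendsto_const_nhds h0 (fun n => zero_le)
    fun n => ?_
  refine eLpNorm_le_mul_eLpNorm_of_ae_le_mul (Eventually.of_forall fun p => ?_) 2
  simp only [Pi.sub_apply]
  rw [← mul_sub, norm_mul]
  exact mul_le_mul_of_nonneg_right (hM p) (norm_nonneg _)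

/-! ### Regularity of the elements of `X^s` -/

theorem one_le_weight (ζ : Plane) : 1 ≤ 1 + freqX ζ ^ 2 + freqY ζ ^ 2 := by
  nlinarith [sq_nonneg (freqX ζ), sq_nonneg (freqY ζ)]

theorem eLpNorm_le_sobolevSq_rpow {s : ℝ} (hs : 0 ≤ s) (h : Plane → ℂ) :
    eLpNorm h 2 volume ≤ sobolevSq s h ^ (1 / 2 : ℝ) := by
  rw [eLpNorm_eq_lintegral_rpow_enorm_toReal (by norm_num) (by norm_num)]
  simp only [ENNReal.toReal_ofNat]
  refine ENNReal.rpow_le_rpow (lintegral_mono fun ζ => ?_) (by norm_num)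
  rw [← ofReal_norm, ENNReal.ofReal_rpow_of_nonneg (norm_nonneg _) (by norm_num)]
  refine ENNReal.ofReal_le_ofReal ?_
  rw [Real.rpow_two]
  exact le_mul_of_one_le_left (by positivity) (Real.one_le_rpow (one_le_weight ζ) hs)

theorem eLpNorm_fourierL2_le_xNorm {s : ℝ} (hs : 0 ≤ s) (f : Plane → ℝ) :
    eLpNorm (fourierL2 f) 2 volume ≤ xNorm s f := by
  refine (eLpNorm_le_sobolevSq_rpow hs _).trans (ENNReal.rpow_le_rpow ?_ (by norm_num))
  rw [add_assoc]
  exact le_self_add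

theorem eLpNorm_symb_mul_le_xNorm {s : ℝ} (hs : 0 ≤ s) (f : Plane → ℝ) :
    eLpNorm (fun ζ => symb 0 ζ * fourierL2 f ζ) 2 volume ≤ xNorm s f :=
  (eLpNorm_le_sobolevSq_rpow hs _).trans (ENNReal.rpow_le_rpow le_add_self (by norm_num))

theorem aestronglyMeasurable_symb_mul (i : Fin 2) {h : Plane → ℂ}
    (hh : AEStronglyMeasurable h volume) :
    AEStronglyMeasurable (fun ζ => symb i ζ * h ζ) volume :=
  (continuous_symb i).aestronglyMeasurable.mul hh

theorem MemX.exists_hasFourierDeriv {s : ℝ} (hs : 0 ≤ s) {f : Plane → ℝ} (hf : MemX s f) :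
    ∃ f', HasFourierDeriv 0 f f' :=
  CHKP.exists_hasFourierDeriv hf.1
    ⟨aestronglyMeasurable_symb_mul 0 (memLp_fourierL2 f).1,
      (eLpNorm_symb_mul_le_xNorm hs f).trans_lt hf.2⟩

theorem memLp_weight_mul {s : ℝ} (hs : 2 ≤ s) {h : Plane → ℂ}
    (hh : AEStronglyMeasurable h volume) (hfin : sobolevSq s h < ⊤) :
    MemLp (fun ζ => ((1 + freqX ζ ^ 2 + freqY ζ ^ 2 : ℝ) : ℂ) * h ζ) 2 volume := by
  have hc : Continuous fun ζ : Plane => ((1 + freqX ζ ^ 2 + freqY ζ ^ 2 : ℝ) : ℂ) := by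
    unfold freqX freqY
    fun_prop
  refine ⟨hc.aestronglyMeasurable.mul hh, ?_⟩
  rw [eLpNorm_eq_lintegral_rpow_enorm_toReal (by norm_num) (by norm_num)]
  refine ENNReal.rpow_lt_top_of_nonneg (by norm_num) (lt_of_le_of_lt ?_ hfin).ne
  refine lintegral_mono fun ζ => ?_
  simp only [ENNReal.toReal_ofNat]
  rw [← ofReal_norm, ENNReal.ofReal_rpow_of_nonneg (norm_nonneg _) (by norm_num)]
  refine ENNReal.ofReal_le_ofReal ?_
  have h1 := one_le_weight ζ
  rw [Real.rpow_two, norm_mul, Complex.norm_real, Real.norm_of_nonneg (by linarith), mul_pow]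
  refine mul_le_mul_of_nonneg_right ?_ (by positivity)
  rw [← Real.rpow_two]
  exact Real.rpow_le_rpow_of_exponent_le h1 hs

theorem norm_symb_le_weight (i : Fin 2) (ζ : Plane) :
    ‖symb i ζ‖ ≤ 1 + freqX ζ ^ 2 + freqY ζ ^ 2 := by
  have h0 : ‖symb 0 ζ‖ = |freqX ζ| := by simp [symb, freqX]
  have h1 : ‖symb 1 ζ‖ = |freqY ζ| := by simp [symb, freqY]
  have hX := sq_nonneg (|freqX ζ| - 1)
  have hY := sq_nonneg (|freqY ζ| - 1)
  have := sq_abs (freqX ζ)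
  have := sq_abs (freqY ζ)
  have := abs_nonneg (freqX ζ)
  have := abs_nonneg (freqY ζ)
  fin_cases i
  · simp only [Fin.zero_eta, h0]
    nlinarith
  · simp only [Fin.mk_one, h1]
    nlinarith

theorem memLp_symb_mul_of_sobolevSq {s : ℝ} (hs : 2 ≤ s) (i : Fin 2) {h : Plane → ℂ}
    (hh : AEStronglyMeasurable h volume) (hfin : sobolevSq s h < ⊤) :
    MemLp (fun ζ => symb i ζ * h ζ) 2 volume := by
  refine (memLp_weight_mul hs hh hfin).mono (aestronglyMeasurable_symb_mul i hh)
    (Eventually.of_forall fun ζ => ?_)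
  rw [norm_mul, norm_mul, Complex.norm_real,
    Real.norm_of_nonneg (by linarith [one_le_weight ζ])]
  exact mul_le_mul_of_nonneg_right (norm_symb_le_weight i ζ) (norm_nonneg _)

/-- The Sobolev embedding `H² ⊆ L^∞` in the plane, on the Fourier side: the inverse weight is
square integrable. -/
theorem integrable_of_sobolevSq {s : ℝ} (hs : 2 ≤ s) {h : Plane → ℂ}
    (hh : AEStronglyMeasurable h volume) (hfin : sobolevSq s h < ⊤) : Integrable h volume := by
  have hc : Continuous fun ζ : Plane => ((1 + freqX ζ ^ 2 + freqY ζ ^ 2 : ℝ) : ℂ)⁻¹ := by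
    refine Continuous.inv₀ ?_ fun ζ => ?_
    · unfold freqX freqY
      fun_prop
    · exact_mod_cast (by linarith [one_le_weight ζ] : 1 + freqX ζ ^ 2 + freqY ζ ^ 2 ≠ 0)
  have hw : MemLp (fun ζ : Plane => ((1 + freqX ζ ^ 2 + freqY ζ ^ 2 : ℝ) : ℂ)⁻¹) 2 volume := by
    rw [memLp_two_iff_integrable_sq_norm hc.aestronglyMeasurable]
    have hJ : Integrable (fun ζ : Plane => ((1 : ℝ) + ‖ζ‖ ^ 2) ^ (-(4 : ℝ) / 2)) volume :=
      integrable_rpow_neg_one_add_norm_sq (by simp; norm_num)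
    refine hJ.mono' (hc.norm.pow 2).aestronglyMeasurable (Eventually.of_forall fun ζ => ?_)
    have h1 : 1 + ‖ζ‖ ^ 2 ≤ 1 + freqX ζ ^ 2 + freqY ζ ^ 2 := by
      rw [EuclideanSpace.norm_sq_eq, Fin.sum_univ_two]
      simp only [freqX, freqY, mul_pow, Real.norm_eq_abs, sq_abs]
      have h3 : (1 : ℝ) ≤ 2 ^ 2 * Real.pi ^ 2 := by nlinarith [Real.pi_gt_three]
      nlinarith [sq_nonneg (ζ 0), sq_nonneg (ζ 1)]
    have h2 : (0 : ℝ) < 1 + ‖ζ‖ ^ 2 := by positivity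
    rw [Real.norm_of_nonneg (sq_nonneg _), norm_inv, Complex.norm_real,
      Real.norm_of_nonneg (by linarith [one_le_weight ζ]),
      show (-(4 : ℝ) / 2) = -(2 : ℝ) by norm_num,
      Real.rpow_neg h2.le, Real.rpow_two, inv_pow]
    exact inv_anti₀ (by positivity) (pow_le_pow_left₀ h2.le h1 2)
  have := hw.integrable_mul (memLp_weight_mul hs hh hfin)
  refine this.congr (Eventually.of_forall fun ζ => ?_)
  have hne : ((1 + freqX ζ ^ 2 + freqY ζ ^ 2 : ℝ) : ℂ) ≠ 0 := by
    exact_mod_cast (by linarith [one_le_weight ζ] : 1 + freqX ζ ^ 2 + freqY ζ ^ 2 ≠ 0)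
  simp only [Pi.mul_apply]
  rw [inv_mul_cancel_left₀ hne]

theorem MemX.sobolevSq_lt_top {s : ℝ} {f : Plane → ℝ} (hf : MemX s f) :
    sobolevSq s (fourierL2 f) < ⊤ ∧ sobolevSq s (fun ζ => symb 0 ζ * fourierL2 f ζ) < ⊤ := by
  have h := hf.2
  rw [xNorm, ENNReal.rpow_lt_top_iff_of_pos (by norm_num), ENNReal.add_lt_top,
    ENNReal.add_lt_top] at h
  exact ⟨h.1.1, h.2⟩

/-- A continuous element of `X^s`, `s ≥ 2`, is bounded and continuously differentiable in `x` with
a bounded derivative, and it has the square integrable weak derivatives `f_x`, `f_xx`, `f_y`. -/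
theorem MemX.regularity {s : ℝ} (hs : 2 ≤ s) {f : Plane → ℝ} (hf : MemX s f)
    (hc : Continuous f) : ∃ (fx fxx fy : Plane → ℝ) (M : ℝ), HasFourierDeriv 0 f fx ∧
      HasFourierDeriv 0 fx fxx ∧ HasFourierDeriv 1 f fy ∧ Continuous fx ∧
      (∀ x y : ℝ, HasDerivAt (fun x : ℝ => f !₂[x, y]) (fx !₂[x, y]) x) ∧
      (∀ p, |f p| ≤ M) ∧ (∀ p, |fx p| ≤ M) := by
  obtain ⟨hS, hS'⟩ := hf.sobolevSq_lt_top
  have hm := (memLp_fourierL2 f).1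
  have hm' := aestronglyMeasurable_symb_mul 0 hm
  have hi := integrable_of_sobolevSq hs hm hS
  have hi' := integrable_of_sobolevSq hs hm' hS'
  obtain ⟨f', hf'⟩ := hf.exists_hasFourierDeriv (by linarith)
  obtain ⟨fy, hfy⟩ := CHKP.exists_hasFourierDeriv (i := 1) hf.1
    (memLp_symb_mul_of_sobolevSq hs 1 hm hS)
  have hfeq : (fun p => (f p : ℂ)) = 𝓕⁻ (fourierL2 f) :=
    (Continuous.ae_eq_iff_eq volume (by fun_prop) (continuous_fourierInv hi)).1
      (ae_eq_fourierInv_fourierL2 hf.1 hi)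
  have hfp : ∀ p, f p = (𝓕⁻ (fourierL2 f) p).re := fun p => by
    rw [← hfeq, Complex.ofReal_re]
  set fx : Plane → ℝ := fun p => (𝓕⁻ (fun ζ => symb 0 ζ * fourierL2 f ζ) p).re with hfx
  -- The derivative `f'` in `L²` has an integrable Fourier transform, hence the representative `fx`.
  have hxeq : f' =ᵐ[volume] fx := by
    have h1 := ae_eq_fourierInv_fourierL2 hf'.2 (hi'.congr hf'.3.symm)
    have h2 : 𝓕⁻ (fourierL2 f') = 𝓕⁻ (fun ζ => symb 0 ζ * fourierL2 f ζ) := by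
      ext p
      rw [Real.fourierInv_eq', Real.fourierInv_eq']
      apply integral_congr_ae
      filter_upwards [hf'.3] with ζ hζ
      rw [hζ]
    filter_upwards [h1] with p hp
    simp only [hfx]
    rw [← h2, ← hp, Complex.ofReal_re]
  have hfx' : HasFourierDeriv 0 f fx := hf'.congr EventuallyEq.rfl hxeq
  obtain ⟨fxx, hfxx⟩ := CHKP.exists_hasFourierDeriv (i := 0) hfx'.2
    ((memLp_congr_ae (f := fun ζ => symb 0 ζ * fourierL2 fx ζ)
      (g := fun ζ => symb 0 ζ * (symb 0 ζ * fourierL2 f ζ)) (by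
      filter_upwards [hfx'.3] with ζ hζ
      rw [hζ])).2 (memLp_symb_mul_of_sobolevSq hs 0 hm' hS'))
  refine ⟨fx, fxx, fy, max (∫ ζ, ‖fourierL2 f ζ‖) (∫ ζ, ‖symb 0 ζ * fourierL2 f ζ‖), hfx', hfxx,
    hfy, Complex.continuous_re.comp (continuous_fourierInv hi'), fun x y => ?_, fun p => ?_,
    fun p => ?_⟩
  · simp only [hfp]
    exact Complex.reCLM.hasFDerivAt.comp_hasDerivAt x (hasDerivAt_fourierInv hi hi' x y)
  · rw [hfp]
    exact (Complex.abs_re_le_norm _).trans ((norm_fourierInv_le _ p).trans (le_max_left _ _))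
  · exact (Complex.abs_re_le_norm _).trans ((norm_fourierInv_le _ p).trans (le_max_right _ _))

/-! ### Integration along horizontal lines -/

/-- The coordinate map from `ℝ × ℝ` to the plane, with the vertical coordinate first. -/
def ofYX (q : ℝ × ℝ) : Plane := !₂[q.2, q.1]

theorem measurePreserving_ofYX : MeasurePreserving ofYX volume volume := by
  have h1 : MeasurePreserving (Prod.swap : ℝ × ℝ → ℝ × ℝ) volume volume :=
    Measure.measurePreserving_swap
  have h2 := (volume_preserving_finTwoArrow ℝ).symm
  have h3 := PiLp.volume_preserving_toLp (Fin 2)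
  have h := h3.comp (h2.comp h1)
  have e : ofYX = WithLp.toLp 2 ∘ (MeasurableEquiv.finTwoArrow (α := ℝ)).symm ∘ Prod.swap := by
    ext q i
    fin_cases i <;> rfl
  rw [e]
  exact h

theorem measurableEmbedding_ofYX : MeasurableEmbedding ofYX := by
  have e : ofYX = (MeasurableEquiv.toLp 2 (Fin 2 → ℝ)) ∘
      (MeasurableEquiv.finTwoArrow (α := ℝ)).symm ∘
        (MeasurableEquiv.prodComm (α := ℝ) (β := ℝ)) := by
    ext q i
    fin_cases i <;> rfl
  rw [e]
  exact (MeasurableEquiv.measurableEmbedding _).comp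
    ((MeasurableEquiv.measurableEmbedding _).comp (MeasurableEquiv.measurableEmbedding _))

theorem integrable_comp_ofYX {f : Plane → ℝ} (hf : Integrable f volume) :
    Integrable (fun q : ℝ × ℝ => f !₂[q.2, q.1]) (volume.prod volume) :=
  (measurePreserving_ofYX.integrable_comp_emb measurableEmbedding_ofYX).2 hf

theorem integral_eq_integral_lines {f : Plane → ℝ} (hf : Integrable f volume) :
    ∫ p, f p = ∫ y : ℝ, ∫ x : ℝ, f !₂[x, y] := by
  rw [← measurePreserving_ofYX.integral_comp measurableEmbedding_ofYX]
  exact integral_prod _ (integrable_comp_ofYX hf)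

theorem ae_integrable_lines {f : Plane → ℝ} (hf : Integrable f volume) :
    ∀ᵐ y : ℝ, Integrable (fun x : ℝ => f !₂[x, y]) volume :=
  (integrable_comp_ofYX hf).prod_right_ae

theorem ae_ae_lines {P : Plane → Prop} (h : ∀ᵐ p, P p) :
    ∀ᵐ y : ℝ, ∀ᵐ x : ℝ, P !₂[x, y] :=
  Measure.ae_ae_of_ae_prod (measurePreserving_ofYX.quasiMeasurePreserving.ae h)

theorem ae_memLp_lines {f : Plane → ℝ} (hf : MemLp f 2 volume) :
    ∀ᵐ y : ℝ, MemLp (fun x : ℝ => f !₂[x, y]) 2 volume := by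
  have h1 : AEStronglyMeasurable (fun q : ℝ × ℝ => f !₂[q.2, q.1]) (volume.prod volume) :=
    hf.1.comp_measurePreserving measurePreserving_ofYX
  filter_upwards [h1.prodMk_left, ae_integrable_lines hf.integrable_sq] with y hy hy'
  exact (memLp_two_iff_integrable_sq hy).2 hy'

/-- The integral of the `x`-derivative of an integrable function vanishes. -/
theorem integral_deriv_eq_zero {f f' : Plane → ℝ} (hf : Integrable f volume)
    (hf' : Integrable f' volume)
    (hd : ∀ x y : ℝ, HasDerivAt (fun x : ℝ => f !₂[x, y]) (f' !₂[x, y]) x) :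
    ∫ p, f' p = 0 := by
  rw [integral_eq_integral_lines hf']
  have : ∀ᵐ y : ℝ, ∫ x : ℝ, f' !₂[x, y] = 0 := by
    filter_upwards [ae_integrable_lines hf, ae_integrable_lines hf'] with y h1 h2
    exact integral_eq_zero_of_hasDerivAt_of_integrable (fun x => hd x y) h2 h1
  rw [integral_congr_ae this, integral_zero]

/-! ### The resolvent kernel `G` -/

theorem G_nonneg (x : ℝ) : 0 ≤ G x := by
  unfold G
  positivity

theorem G_sub_comm (x z : ℝ) : G (x - z) = G (z - x) := by
  unfold G
  rw [abs_sub_comm]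

theorem continuous_G : Continuous G := by
  unfold G
  fun_prop

theorem integrable_G : Integrable G volume := by
  unfold G
  refine Integrable.const_mul ?_ _
  rw [← integrableOn_univ, ← Set.Iic_union_Ioi (a := (0 : ℝ))]
  refine IntegrableOn.union ?_ ?_
  · refine (integrableOn_exp_Iic 0).congr_fun (fun x hx => ?_) measurableSet_Iic
    rw [abs_of_nonpos hx, neg_neg]
  · refine (integrableOn_exp_neg_Ioi 0).congr_fun (fun x hx => ?_) measurableSet_Ioi
    rw [abs_of_pos hx]

theorem integrable_G_mul {x C : ℝ} {f : ℝ → ℝ} (hf : Continuous f) (hC : ∀ z, |f z| ≤ C) :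
    Integrable (fun z => G (x - z) * f z) volume :=
  (integrable_G.comp_sub_left x).mul_bdd hf.aestronglyMeasurable (Eventually.of_forall hC)

/-- `G` is the kernel of `(1 - ∂ₓ²)⁻¹`. -/
theorem integral_G_mul_sub {φ φ₁ φ₂ : ℝ → ℝ} {C : ℝ} (h1 : ∀ z, HasDerivAt φ (φ₁ z) z)
    (h2 : ∀ z, HasDerivAt φ₁ (φ₂ z) z) (hc : Continuous φ₂) (hC : ∀ z, |φ z| ≤ C)
    (hC₁ : ∀ z, |φ₁ z| ≤ C) (hC₂ : ∀ z, |φ₂ z| ≤ C) (x : ℝ) :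
    ∫ z, G (x - z) * (φ z - φ₂ z) = φ x := by
  have cφ : Continuous φ := continuous_iff_continuousAt.2 fun z => (h1 z).continuousAt
  have hint : Integrable (fun z => G (x - z) * (φ z - φ₂ z)) volume :=
    integrable_G_mul (C := C + C) (cφ.sub hc)
      fun z => (abs_sub _ _).trans (add_le_add (hC z) (hC₂ z))
  -- On each half-line the integrand is the derivative of `±e^{∓(x - z)} (φ ∓ φ₁) / 2`.
  have eL : ∫ z in Set.Iic x, G (x - z) * (φ z - φ₂ z) =
      1 / 2 * Real.exp (x - x) * (φ x - φ₁ x) - 0 := by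
    have e : ∀ z ∈ Set.Iic x, G (x - z) * (φ z - φ₂ z) =
        1 / 2 * Real.exp (z - x) * (φ z - φ₂ z) := by
      intro z hz
      unfold G
      rw [abs_of_nonneg (sub_nonneg.2 hz), neg_sub]
    rw [setIntegral_congr_fun measurableSet_Iic e]
    refine integral_Iic_of_hasDerivAt_of_tendsto'
      (f := fun z => 1 / 2 * Real.exp (z - x) * (φ z - φ₁ z)) (fun z _ => ?_)
      (hint.integrableOn.congr_fun e measurableSet_Iic) ?_
    · have := ((((hasDerivAt_id z).sub_const x).exp).const_mul (1 / 2)).mul ((h1 z).sub (h2 z))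
      refine this.congr_deriv ?_
      simp
      ring
    · have h0 : Tendsto (fun z : ℝ => 1 / 2 * Real.exp (z - x) * (C + C)) atBot
          (𝓝 (1 / 2 * 0 * (C + C))) :=
        ((Real.tendsto_exp_atBot.comp (tendsto_atBot_add_const_right _ (-x) tendsto_id)).const_mul
          _).mul_const _
      rw [mul_zero, zero_mul] at h0
      refine squeeze_zero_norm (fun z => ?_) h0
      rw [norm_mul, Real.norm_of_nonneg (by positivity : 0 ≤ 1 / 2 * Real.exp (z - x))]
      exact mul_le_mul_of_nonneg_left
        ((abs_sub _ _).trans (add_le_add (hC z) (hC₁ z))) (by positivity)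
  have eR : ∫ z in Set.Ioi x, G (x - z) * (φ z - φ₂ z) =
      0 - -(1 / 2 * Real.exp (x - x) * (φ x + φ₁ x)) := by
    have e : ∀ z ∈ Set.Ioi x, G (x - z) * (φ z - φ₂ z) =
        1 / 2 * Real.exp (x - z) * (φ z - φ₂ z) := by
      intro z hz
      unfold G
      rw [abs_of_nonpos (sub_nonpos.2 (le_of_lt hz)), neg_neg]
    rw [setIntegral_congr_fun measurableSet_Ioi e]
    refine integral_Ioi_of_hasDerivAt_of_tendsto'
      (f := fun z => -(1 / 2 * Real.exp (x - z) * (φ z + φ₁ z))) (fun z _ => ?_)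
      (hint.integrableOn.congr_fun e measurableSet_Ioi) ?_
    · have := (((((hasDerivAt_id z).const_sub x).exp).const_mul (1 / 2)).mul
        ((h1 z).add (h2 z))).neg
      refine this.congr_deriv ?_
      simp
      ring
    · have h0 : Tendsto (fun z : ℝ => 1 / 2 * Real.exp (x - z) * (C + C)) atTop
          (𝓝 (1 / 2 * 0 * (C + C))) := by
        refine ((Real.tendsto_exp_atBot.comp ?_).const_mul _).mul_const _
        exact (tendsto_atBot_add_const_left _ x tendsto_neg_atTop_atBot).congr fun z =>
          (sub_eq_add_neg x z).symm
      rw [mul_zero, zero_mul] at h0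
      refine squeeze_zero_norm (fun z => ?_) h0
      rw [norm_neg, norm_mul, Real.norm_of_nonneg (by positivity : 0 ≤ 1 / 2 * Real.exp (x - z))]
      exact mul_le_mul_of_nonneg_left
        ((abs_add_le _ _).trans (add_le_add (hC z) (hC₁ z))) (by positivity)
  rw [← integral_add_compl measurableSet_Iic hint, Set.compl_Iic, eL, eR]
  simp
  ring

/-- Convolution with `G` is symmetric on `L²(ℝ)`. -/
theorem integral_conv_G_mul {f k : ℝ → ℝ} (hf : MemLp f 2 volume) (hk : MemLp k 2 volume) :
    ∫ x, (∫ z, G (x - z) * f z) * k x = ∫ z, f z * ∫ x, G (z - x) * k x := by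
  have i1 : Integrable (fun q : ℝ × ℝ => f q.2 ^ 2 * G (q.1 - q.2)) (volume.prod volume) :=
    hf.integrable_sq.convolution_integrand (ContinuousLinearMap.mul ℝ ℝ) integrable_G
  have i2 : Integrable (fun q : ℝ × ℝ => k q.1 ^ 2 * G (q.2 - q.1)) (volume.prod volume) :=
    (hk.integrable_sq.convolution_integrand (ContinuousLinearMap.mul ℝ ℝ) integrable_G).swap
  have hi : Integrable (fun q : ℝ × ℝ => G (q.1 - q.2) * f q.2 * k q.1) (volume.prod volume) := by
    refine (i1.add i2).mono' ?_ (Eventually.of_forall fun q => ?_)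
    · exact ((continuous_G.comp (by fun_prop : Continuous fun q : ℝ × ℝ =>
        q.1 - q.2)).aestronglyMeasurable.mul hf.1.comp_snd).mul hk.1.comp_fst
    · rw [Pi.add_apply, G_sub_comm q.2 q.1, mul_assoc, norm_mul, Real.norm_of_nonneg (G_nonneg _),
        ← add_mul, mul_comm]
      refine mul_le_mul_of_nonneg_right ?_ (G_nonneg _)
      rw [Real.norm_eq_abs, abs_mul, ← sq_abs (f q.2), ← sq_abs (k q.1)]
      nlinarith [sq_nonneg (|f q.2| - |k q.1|), sq_nonneg (|f q.2| + |k q.1|)]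
  have := integral_integral_swap (f := fun x z => G (x - z) * f z * k x) hi
  simp only [integral_mul_const] at this
  rw [this]
  congr 1
  ext z
  rw [← integral_const_mul]
  congr 1
  ext x
  rw [G_sub_comm]
  ring

/-- If `K = G * H`, then `K - K_xx = H` when tested against a function which is bounded along
horizontal lines together with its `x`-derivatives up to order two. -/
theorem integral_mul_sub_of_convG {H K φ φ₁ φ₂ : Plane → ℝ} (hH : MemLp H 2 volume)
    (hK : MemLp K 2 volume) (hHK : K =ᵐ[volume] convG H) (hφ : MemLp φ 2 volume)
    (hφ₂ : MemLp φ₂ 2 volume)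
    (h1 : ∀ x y : ℝ, HasDerivAt (fun x : ℝ => φ !₂[x, y]) (φ₁ !₂[x, y]) x)
    (h2 : ∀ x y : ℝ, HasDerivAt (fun x : ℝ => φ₁ !₂[x, y]) (φ₂ !₂[x, y]) x)
    (hc : Continuous φ₂)
    (hb : ∃ C, ∀ p, |φ p| ≤ C ∧ |φ₁ p| ≤ C ∧ |φ₂ p| ≤ C) :
    ∫ p, K p * (φ p - φ₂ p) = ∫ p, H p * φ p := by
  obtain ⟨C, hC⟩ := hb
  rw [integral_eq_integral_lines (f := fun p => K p * (φ p - φ₂ p))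
    (integrable_mul_of_memLp hK (hφ.sub hφ₂)),
    integral_eq_integral_lines (integrable_mul_of_memLp hH hφ)]
  apply integral_congr_ae
  filter_upwards [ae_memLp_lines hH,
    ae_memLp_lines (f := fun p => φ p - φ₂ p) (hφ.sub hφ₂), ae_ae_lines hHK] with y a1 a2 a3
  have e : ∫ x : ℝ, K !₂[x, y] * (φ !₂[x, y] - φ₂ !₂[x, y]) =
      ∫ x : ℝ, (∫ z : ℝ, G (x - z) * H !₂[z, y]) * (φ !₂[x, y] - φ₂ !₂[x, y]) := by
    apply integral_congr_ae
    filter_upwards [a3] with x hx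
    rw [hx]
    simp [convG]
  rw [e, integral_conv_G_mul a1 a2]
  congr 1
  ext z
  congr 1
  have hcy : Continuous fun x : ℝ => φ₂ !₂[x, y] := hc.comp (by fun_prop)
  exact integral_G_mul_sub (fun x => h1 x y) (fun x => h2 x y) hcy (fun x => (hC _).1)
    (fun x => (hC _).2.1) (fun x => (hC _).2.2) z

theorem ae_of_ae_snd {P : ℝ → Prop} (h : ∀ᵐ y : ℝ, P y) : ∀ᵐ p : Plane, P (p 1) := by
  rw [← measurePreserving_ofYX.map_eq, measurableEmbedding_ofYX.ae_map_iff]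
  exact Measure.quasiMeasurePreserving_fst.ae h

theorem memLp_G : MemLp G 2 volume := by
  rw [memLp_two_iff_integrable_sq continuous_G.aestronglyMeasurable]
  refine integrable_G.mono' (continuous_G.pow 2).aestronglyMeasurable
    (Eventually.of_forall fun x => ?_)
  have h0 := G_nonneg x
  have h1 : G x ≤ 1 := by
    have : Real.exp (-|x|) ≤ 1 := Real.exp_le_one_iff.2 (by simp)
    unfold G
    linarith
  rw [Real.norm_of_nonneg (by positivity)]
  nlinarith

theorem convG_add {f k : Plane → ℝ} (hf : MemLp f 2 volume) (hk : MemLp k 2 volume) :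
    convG (f + k) =ᵐ[volume] convG f + convG k := by
  filter_upwards [ae_of_ae_snd (ae_memLp_lines hf), ae_of_ae_snd (ae_memLp_lines hk)] with p h1 h2
  have hG : MemLp (fun z => G (p 0 - z)) 2 volume :=
    memLp_G.comp_measurePreserving (Measure.measurePreserving_sub_left volume (p 0))
  simp only [convG, Pi.add_apply, mul_add]
  exact integral_add (hG.integrable_mul h1) (hG.integrable_mul h2)

/-! ### Integral identities for the nonlinear terms -/

/-- A smooth nonlinearity above `γ r²` that vanishes at `0` is quadratically small, since `0` is a
minimum of `g r - γ r²`. -/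
theorem exists_abs_le_mul_sq {γ : ℝ} {g : ℝ → ℝ} (hg : ContDiff ℝ ∞ g) (hg0 : g 0 = 0)
    (hge : ∀ r : ℝ, γ * r ^ 2 ≤ g r) (M : ℝ) : ∃ C, 0 ≤ C ∧ ∀ r, |r| ≤ M → |g r| ≤ C * r ^ 2 := by
  have hd : Differentiable ℝ g := hg.differentiable (by simp)
  have hg' : ContDiff ℝ ∞ (deriv g) := (contDiff_infty_iff_deriv.1 hg).2
  have hd' : Differentiable ℝ (deriv g) := hg'.differentiable (by simp)
  have hg'' : Continuous (deriv (deriv g)) := (contDiff_infty_iff_deriv.1 hg').2.continuous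
  have h0 : deriv g 0 = 0 := by
    have h1 : HasDerivAt (fun r => g r - γ * r ^ 2) (deriv g 0 - γ * (2 * 0 ^ 1)) 0 := by
      exact ((hd 0).hasDerivAt.fun_sub ((hasDerivAt_pow 2 (0 : ℝ)).const_mul γ)).congr_deriv
        (by simp)
    have hmin : IsLocalMin (fun r => g r - γ * r ^ 2) 0 := Eventually.of_forall fun r => by
      simp only [hg0]
      linarith [hge r]
    have := hmin.hasDerivAt_eq_zero h1
    simpa using this
  obtain ⟨C, hC⟩ := (isCompact_Icc (a := -M) (b := M)).exists_bound_of_continuousOn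
    hg''.continuousOn
  refine ⟨max C 0, le_max_right _ _, fun r hr => ?_⟩
  have hsub : ∀ z ∈ Set.Icc (-|r|) |r|, z ∈ Set.Icc (-M) M := fun z hz =>
    ⟨by linarith [hz.1], by linarith [hz.2]⟩
  have hzero : (0 : ℝ) ∈ Set.Icc (-|r|) |r| := ⟨by simp, abs_nonneg r⟩
  have b1 : ∀ z ∈ Set.Icc (-|r|) |r|, ‖deriv g z‖ ≤ max C 0 * |r| := by
    intro z hz
    have := (convex_Icc (-|r|) |r|).norm_image_sub_le_of_norm_deriv_le (f := deriv g)
      (fun w _ => hd' w) (fun w hw => (hC w (hsub w hw)).trans (le_max_left C 0)) hzero hz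
    rw [h0, sub_zero, sub_zero] at this
    exact this.trans (mul_le_mul_of_nonneg_left (abs_le.2 ⟨hz.1, hz.2⟩) (le_max_right _ _))
  have b2 := (convex_Icc (-|r|) |r|).norm_image_sub_le_of_norm_deriv_le (f := g)
    (fun w _ => hd w) b1 hzero (y := r) ⟨neg_abs_le r, le_abs_self r⟩
  rw [hg0, sub_zero, sub_zero, Real.norm_eq_abs, Real.norm_eq_abs, mul_assoc, ← sq, sq_abs] at b2
  exact b2

/-- `∫ B(u) u_x = 0`, because `B(u) u_x` is the `x`-derivative of `A(u)` for a primitive `A` of `B`.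
The quadratic bound on `B` makes both functions integrable. -/
theorem integral_comp_mul_deriv_eq_zero {u ux : Plane → ℝ} {M : ℝ} (hu : Continuous u)
    (hux : Continuous ux) (hu2 : MemLp u 2 volume)
    (hd : ∀ x y : ℝ, HasDerivAt (fun x : ℝ => u !₂[x, y]) (ux !₂[x, y]) x)
    (hM : ∀ p, |u p| ≤ M) (hM' : ∀ p, |ux p| ≤ M) {B : ℝ → ℝ} (hB : Continuous B) {C : ℝ}
    (hC0 : 0 ≤ C) (hC : ∀ r, |r| ≤ M → |B r| ≤ C * r ^ 2) : ∫ p, B (u p) * ux p = 0 := by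
  set A : ℝ → ℝ := fun r => ∫ z in (0 : ℝ)..r, B z with hA
  have hA' : ∀ r, HasDerivAt A (B r) r := fun r =>
    intervalIntegral.integral_hasDerivAt_right (hB.intervalIntegrable _ _)
      hB.stronglyMeasurable.stronglyMeasurableAtFilter hB.continuousAt
  have hAc : Continuous A := continuous_iff_continuousAt.2 fun r => (hA' r).continuousAt
  have hM0 : 0 ≤ M := (abs_nonneg _).trans (hM 0)
  have hAb : ∀ r, |r| ≤ M → |A r| ≤ C * M * r ^ 2 := by
    intro r hr
    have := intervalIntegral.norm_integral_le_of_norm_le_const (a := 0) (b := r) (f := B)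
      (C := C * r ^ 2) (fun z hz => by
        have hz' : |z| ≤ |r| := by
          rcases Set.mem_uIoc.1 hz with h | h
          · rw [abs_of_pos h.1, abs_of_nonneg (h.1.le.trans h.2)]
            exact h.2
          · rw [abs_of_nonpos h.2, abs_of_neg (h.1.trans_le h.2)]
            linarith [h.1]
        refine (hC z (hz'.trans hr)).trans (mul_le_mul_of_nonneg_left ?_ hC0)
        exact sq_le_sq.2 hz')
    rw [sub_zero, Real.norm_eq_abs] at this
    refine this.trans ?_
    have : C * r ^ 2 * |r| ≤ C * r ^ 2 * M := mul_le_mul_of_nonneg_left hr (by positivity)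
    linarith
  have hsq := hu2.integrable_sq
  refine integral_deriv_eq_zero (f := fun p => A (u p)) ?_ ?_ fun x y => (hA' _).comp x (hd x y)
  · refine (hsq.const_mul (C * M)).mono' (hAc.comp hu).aestronglyMeasurable
      (Eventually.of_forall fun p => hAb _ (hM p))
  · refine (hsq.const_mul (C * M)).mono' ((hB.comp hu).mul hux).aestronglyMeasurable
      (Eventually.of_forall fun p => ?_)
    rw [norm_mul]
    have := mul_le_mul (hC _ (hM p)) (hM' p) (abs_nonneg _) (by positivity)
    calc _ ≤ _ := this
      _ = _ := by ring

/-- `∫ u_x³ + 2 ∫ u u_x u_xx = 0`. Only `u_x`, not `u_xx`, is classical, so the identity is proved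
for frequency truncations of `u_x` and `u_xx`. -/
theorem integral_mul_deriv_mul_deriv {u ux uxx : Plane → ℝ} {M : ℝ} (hu : Continuous u)
    (hux : Continuous ux) (h2 : HasFourierDeriv 0 ux uxx)
    (hd : ∀ x y : ℝ, HasDerivAt (fun x : ℝ => u !₂[x, y]) (ux !₂[x, y]) x)
    (hM : ∀ p, |u p| ≤ M) (hM' : ∀ p, |ux p| ≤ M) :
    (∫ p, ux p * ux p * ux p) + 2 * ∫ p, u p * ux p * uxx p = 0 := by
  have hb := fun n => memLp_lowPass n ux
  have hc := fun n => memLp_lowPass n uxx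
  have hub := fun n => memLp_bounded_mul hu.aestronglyMeasurable hM (hb n)
  have hxb := fun n => memLp_bounded_mul hux.aestronglyMeasurable hM' (hb n)
  have key : ∀ n, (∫ p, ux p * lowPass n ux p * lowPass n ux p) +
      2 * ∫ p, u p * lowPass n ux p * lowPass n uxx p = 0 := by
    intro n
    have i1 := integrable_mul_of_memLp (hxb n) (hb n)
    have i2 := integrable_mul_of_memLp (hub n) (hc n)
    have := integral_deriv_eq_zero (f := fun p => u p * lowPass n ux p * lowPass n ux p)
      (f' := fun p => ux p * lowPass n ux p * lowPass n ux p +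
        2 * (u p * lowPass n ux p * lowPass n uxx p))
      (integrable_mul_of_memLp (hub n) (hb n)) (i1.add (i2.const_mul 2)) (fun x y => by
        have h := ((hd x y).mul (h2.hasDerivAt_lowPass n x y)).mul (h2.hasDerivAt_lowPass n x y)
        refine h.congr_deriv ?_
        simp only [Pi.mul_apply]
        ring)
    rwa [integral_add i1 (i2.const_mul 2), integral_const_mul] at this
  have tb := tendsto_lowPass h2.1
  have t1 := tendsto_integral_mul hxb hb (memLp_bounded_mul hux.aestronglyMeasurable hM' h2.1)
    h2.1 (tendsto_eLpNorm_bounded_mul hM' tb) tb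
  have t2 := tendsto_integral_mul hub hc (memLp_bounded_mul hu.aestronglyMeasurable hM h2.1)
    h2.2 (tendsto_eLpNorm_bounded_mul hM tb) (tendsto_lowPass h2.2)
  have t3 := t1.add (t2.const_mul 2)
  simp_rw [key] at t3
  exact tendsto_nhds_unique t3 tendsto_const_nhds

/-- If `K = G * H`, then `K - K_xx = H` when tested against `u ∈ H²`. -/
theorem integral_mul_sub_of_convG_of_hasFourierDeriv {H K u ux uxx : Plane → ℝ}
    (hH : MemLp H 2 volume) (hK : MemLp K 2 volume) (hHK : K =ᵐ[volume] convG H)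
    (h1 : HasFourierDeriv 0 u ux) (h2 : HasFourierDeriv 0 ux uxx) :
    ∫ p, K p * (u p - uxx p) = ∫ p, H p * u p := by
  have key : ∀ n, ∫ p, K p * (lowPass n u p - lowPass n uxx p) = ∫ p, H p * lowPass n u p := by
    intro n
    obtain ⟨C, hC⟩ := exists_abs_lowPass_le n u
    obtain ⟨C₁, hC₁⟩ := exists_abs_lowPass_le n ux
    obtain ⟨C₂, hC₂⟩ := exists_abs_lowPass_le n uxx
    exact integral_mul_sub_of_convG hH hK hHK (memLp_lowPass n u) (memLp_lowPass n uxx)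
      (h1.hasDerivAt_lowPass n) (h2.hasDerivAt_lowPass n) (continuous_lowPass n uxx)
      ⟨max C (max C₁ C₂), fun p => ⟨(hC p).trans (le_max_left _ _),
        (hC₁ p).trans ((le_max_left _ _).trans (le_max_right _ _)),
        (hC₂ p).trans ((le_max_right _ _).trans (le_max_right _ _))⟩⟩
  have ta := tendsto_lowPass h1.1
  have tc := tendsto_lowPass h2.2
  have c0 : ∀ k : Plane → ℝ, Tendsto (fun _ : ℕ => eLpNorm (k - k) 2 (volume : Measure Plane))
      atTop (𝓝 0) := fun k => by simp
  have hK' : ∀ _ : ℕ, MemLp K 2 volume := fun _ => hK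
  have hH' : ∀ _ : ℕ, MemLp H 2 volume := fun _ => hH
  have ma := fun n => memLp_lowPass n u
  have mc := fun n => memLp_lowPass n uxx
  have t1 := (tendsto_integral_mul hK' ma hK h1.1 (c0 K) ta).sub
    (tendsto_integral_mul hK' mc hK h2.2 (c0 K) tc)
  have t2 := tendsto_integral_mul hH' ma hH h1.1 (c0 H) ta
  simp_rw [← key] at t2
  have e : ∀ {a c : Plane → ℝ}, MemLp a 2 volume → MemLp c 2 volume →
      ∫ p, K p * (a p - c p) = (∫ p, K p * a p) - ∫ p, K p * c p := by
    intro a c ha hc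
    simp only [mul_sub]
    exact integral_sub (integrable_mul_of_memLp hK ha) (integrable_mul_of_memLp hK hc)
  simp_rw [e (ma _) (mc _)] at t2
  rw [e h1.1 h2.2]
  exact tendsto_nhds_unique t1 t2

/-! ### Consequences of the system at a fixed time -/

/-- What the system at a fixed time says when it is read off the classical derivative `ux`: all
functions are square integrable, and `K = G * (F_x + v_y)` with `F` the flux. -/
theorem SystemAt.exists_data {γ : ℝ} {g : ℝ → ℝ} (hg : ContDiff ℝ ∞ g) (hg0 : g 0 = 0)
    (hge : ∀ r : ℝ, γ * r ^ 2 ≤ g r) {u ut v ux uy : Plane → ℝ} {M : ℝ} (hu : Continuous u)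
    (hux : Continuous ux) (hM : ∀ p, |u p| ≤ M) (hM' : ∀ p, |ux p| ≤ M)
    (h0 : HasFourierDeriv 0 u ux) (h1 : HasFourierDeriv 1 u uy) (hut : MemLp ut 2 volume)
    (h : SystemAt γ g u ut v) :
    ∃ vy Fx : Plane → ℝ, HasFourierDeriv 0 v uy ∧ HasFourierDeriv 1 v vy ∧ IsWeakDeriv 1 v vy ∧
      HasFourierDeriv 0 (flux γ g u ux) Fx ∧ IsWeakDeriv 0 (flux γ g u ux) Fx ∧
      Integrable (flux γ g u ux) volume ∧
      MemLp (fun p => ut p + γ * (u p * ux p)) 2 volume ∧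
      (fun p => -(ut p + γ * (u p * ux p))) =ᵐ[volume] convG (Fx + vy) := by
  obtain ⟨ux', uy', vy, Fx, hux', huy', hv, hv0, hvy, hv1, hFx, hF, heq⟩ := h
  have ex : ux' =ᵐ[volume] ux := h0.ae_eq hux'
  have ey : uy' =ᵐ[volume] uy := h1.ae_eq huy'
  have eF : flux γ g u ux' =ᵐ[volume] flux γ g u ux := by
    filter_upwards [ex] with p hp
    simp only [flux, hp]
  have hF' := hF.congr eF
  obtain ⟨C, hC0, hC⟩ := exists_abs_le_mul_sq hg hg0 hge M
  have hFc : Continuous (flux γ g u ux) := by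
    have := hg.continuous
    unfold flux
    fun_prop
  have hFb : ∀ p, |flux γ g u ux p| ≤ (C + |γ|) * (u p ^ 2 + ux p ^ 2) := by
    intro p
    have a1 := abs_le.1 (hC _ (hM p))
    have a2 := abs_le.1 (le_refl |γ|)
    have a3 := sq_nonneg (u p)
    have a4 := sq_nonneg (ux p)
    unfold flux
    rw [abs_le]
    constructor <;> nlinarith [mul_nonneg hC0 a3, mul_nonneg hC0 a4, abs_nonneg γ]
  have hM0 : 0 ≤ M := (abs_nonneg _).trans (hM 0)
  have hFi : Integrable (flux γ g u ux) volume :=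
    ((h0.1.integrable_sq.add h0.2.integrable_sq).const_mul (C + |γ|)).mono'
      hFc.aestronglyMeasurable (Eventually.of_forall hFb)
  have hF2 : MemLp (flux γ g u ux) 2 volume := by
    refine MemLp.of_le_mul (g := fun p => |u p| + |ux p|) (c := (C + |γ|) * M)
      (h0.1.abs.add h0.2.abs) hFc.aestronglyMeasurable (Eventually.of_forall fun p => ?_)
    rw [Real.norm_of_nonneg (by positivity : 0 ≤ |u p| + |ux p|)]
    refine (hFb p).trans ?_
    rw [mul_assoc]
    refine mul_le_mul_of_nonneg_left ?_ (by positivity)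
    rw [← sq_abs (u p), ← sq_abs (ux p)]
    nlinarith [hM p, hM' p, abs_nonneg (u p), abs_nonneg (ux p)]
  refine ⟨vy, Fx, ?_, hv1.hasFourierDeriv hv hvy, hv1, hF'.hasFourierDeriv hF2 hFx, hF', hFi, ?_,
    ?_⟩
  · exact (hv0.hasFourierDeriv hv ((memLp_congr_ae ey).2 h1.2)).congr EventuallyEq.rfl ey
  · exact hut.add ((memLp_bounded_mul hu.aestronglyMeasurable hM h0.2).const_mul γ)
  · filter_upwards [heq, ex, convG_add hFx hvy] with p h1 h2 h3
    rw [h3, Pi.add_apply]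
    rw [h2] at h1
    linarith

/-- Conservation of the energy `∫ u² + u_x²`: its time derivative vanishes at each time. -/
theorem SystemAt.integral_energy_eq_zero {γ : ℝ} {g : ℝ → ℝ} (hg : ContDiff ℝ ∞ g) (hg0 : g 0 = 0)
    (hge : ∀ r : ℝ, γ * r ^ 2 ≤ g r) {s : ℝ} (hs : 2 ≤ s) {u ux ut utx v : Plane → ℝ}
    (hu : Continuous u) (hX : MemX s u) (hux : HasFourierDeriv 0 u ux)
    (hut : HasFourierDeriv 0 ut utx) (h : SystemAt γ g u ut v) :
    (∫ p, u p * ut p) + ∫ p, ux p * utx p = 0 := by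
  obtain ⟨w, uxx, uy, M, h1, h2, h3, hwc, hd, hM, hM'⟩ := hX.regularity hs hu
  have hw : ux =ᵐ[volume] w := h1.ae_eq hux.isWeakDeriv
  have hw' : ∫ p, ux p * utx p = ∫ p, w p * utx p :=
    integral_congr_ae (by filter_upwards [hw] with p hp; rw [hp])
  rw [hw']
  obtain ⟨vy, Fx, hv0, hv1, -, hF, -, hFi, hK, hKeq⟩ :=
    h.exists_data hg hg0 hge hu hwc hM hM' h1 h3 hut.1
  have huw := memLp_bounded_mul hu.aestronglyMeasurable hM h1.2
  -- With `K = -(u_t + γ u u_x)`: `∫ K (u - u_xx) = ∫ (F_x + v_y) u`.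
  have e1 := integral_mul_sub_of_convG_of_hasFourierDeriv (hF.2.add hv1.2) hK.neg hKeq h1 h2
  have e2 : ∫ p, (Fx + vy) p * u p = (∫ p, Fx p * u p) + ∫ p, vy p * u p := by
    simp only [Pi.add_apply, add_mul]
    exact integral_add (integrable_mul_of_memLp hF.2 h1.1) (integrable_mul_of_memLp hv1.2 h1.1)
  have e3 := hF.integral_mul h1
  -- `∫ v_y u = -∫ v u_y` and `u_y = v_x`.
  have e4 : ∫ p, vy p * u p = 0 := by
    have a1 := hv1.integral_mul h3
    have a2 := hv0.integral_mul_self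
    simp_rw [mul_comm (v _)] at a1
    linarith
  have e5 := h2.integral_mul hut
  have e6 := integral_mul_deriv_mul_deriv hu hwc h2 hd hM hM'
  obtain ⟨C, hC0, hC⟩ := exists_abs_le_mul_sq hg hg0 hge M
  have z1 := integral_comp_mul_deriv_eq_zero hu hwc h1.1 hd hM hM' (B := fun r => r ^ 2)
    (by fun_prop) zero_le_one (fun r _ => by rw [abs_of_nonneg (sq_nonneg r), one_mul])
  have z2 := integral_comp_mul_deriv_eq_zero hu hwc h1.1 hd hM hM' hg.continuous hC0 hC
  have i1 := integrable_mul_of_memLp (memLp_bounded_mul hu.aestronglyMeasurable hM h1.1) h1.2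
  have i2 := integrable_mul_of_memLp huw h2.2
  have i3 := integrable_mul_of_memLp (memLp_bounded_mul hwc.aestronglyMeasurable hM' h1.2) h1.2
  have i4 : Integrable (fun p => g (u p) * w p) volume := by
    refine ((h1.1.integrable_sq).const_mul (C * M)).mono'
      ((hg.continuous.comp hu).mul hwc).aestronglyMeasurable (Eventually.of_forall fun p => ?_)
    rw [norm_mul]
    calc _ ≤ _ := mul_le_mul (hC _ (hM p)) (hM' p) (abs_nonneg _) (by positivity)
      _ = _ := by ring
  -- In `∫ F u_x` only the cubic term is not a total derivative.
  have e7 : ∫ p, flux γ g u w p * w p = γ / 2 * ∫ p, w p * w p * w p := by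
    have : ∀ p, flux γ g u w p * w p = 1 / 2 * (g (u p) * w p) + γ / 2 * (w p * w p * w p) -
        γ / 2 * (u p * u p * w p) := fun p => by
      unfold flux
      ring
    simp only [this]
    have i5 : Integrable (fun p => 1 / 2 * (g (u p) * w p) + γ / 2 * (w p * w p * w p)) volume :=
      (i4.const_mul _).add (i3.const_mul _)
    rw [integral_sub i5 (i1.const_mul _),
      integral_add (i4.const_mul _) (i3.const_mul _), integral_const_mul, integral_const_mul,
      integral_const_mul, z2]
    simp only [sq] at z1
    rw [z1]
    ring
  have e8 : ∫ p, -(ut p + γ * (u p * w p)) * (u p - uxx p) =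
      -(∫ p, u p * ut p) + (∫ p, uxx p * ut p) - γ * (∫ p, u p * u p * w p) +
        γ * ∫ p, u p * w p * uxx p := by
    have j1 := integrable_mul_of_memLp h1.1 hut.1
    have j2 := integrable_mul_of_memLp h2.2 hut.1
    have : ∀ p, -(ut p + γ * (u p * w p)) * (u p - uxx p) =
      -(u p * ut p) + uxx p * ut p - γ * (u p * u p * w p) + γ * (u p * w p * uxx p) := fun p => by
      ring
    simp only [this]
    have j3 : Integrable (fun p => -(u p * ut p) + uxx p * ut p) volume := j1.neg.add j2
    have j4 : Integrable (fun p => -(u p * ut p) + uxx p * ut p - γ * (u p * u p * w p)) volume :=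
      j3.sub (i1.const_mul _)
    rw [integral_add j4 (i2.const_mul _), integral_sub j3 (i1.const_mul _),
      integral_add (f := fun p => -(u p * ut p)) j1.neg j2, integral_neg,
      integral_const_mul, integral_const_mul]
  simp only [sq] at z1
  simp only [Pi.neg_apply] at e1
  rw [e8, e2, e4, z1] at e1
  rw [e7] at e3
  rw [e5]
  have e9 : (∫ p, w p * w p * w p) = -2 * ∫ p, u p * w p * uxx p := by linarith
  rw [e9] at e3
  linarith

/-! ### Conservation of the energy in time -/

open Classical in
/-- The class in `L²` of a square integrable function, and `0` for all other functions. -/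
def toL2 (f : Plane → ℝ) : Lp ℝ 2 (volume : Measure Plane) :=
  if h : MemLp f 2 volume then h.toLp f else 0

theorem toL2_eq {f : Plane → ℝ} (h : MemLp f 2 volume) : toL2 f = h.toLp f := dif_pos h

theorem toL2_eq_zero_iff {f : Plane → ℝ} (h : MemLp f 2 volume) : toL2 f = 0 ↔ f =ᵐ[volume] 0 := by
  rw [toL2_eq h, ← MemLp.toLp_zero MemLp.zero', MemLp.toLp_eq_toLp_iff]

theorem inner_toL2 {f k : Plane → ℝ} (hf : MemLp f 2 volume) (hk : MemLp k 2 volume) :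
    inner ℝ (toL2 f) (toL2 k) = ∫ p, f p * k p := by
  rw [toL2_eq hf, toL2_eq hk, inner_toLp]

theorem hasDerivWithinAt_toL2 {S : Set ℝ} {w : ℝ → Plane → ℝ} {w' : Plane → ℝ} {t : ℝ}
    (hw : ∀ τ ∈ S, MemLp (w τ) 2 volume) (ht : t ∈ S) (hw' : MemLp w' 2 volume)
    (h : Tendsto (fun τ => eLpNorm ((τ - t)⁻¹ • (w τ - w t) - w') 2 volume)
      (𝓝[S \ {t}] t) (𝓝 0)) :
    HasDerivWithinAt (fun τ => toL2 (w τ)) (toL2 w') S t := by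
  rw [hasDerivWithinAt_iff_tendsto_slope, tendsto_iff_norm_sub_tendsto_zero]
  have h0 := (ENNReal.tendsto_toReal ENNReal.zero_ne_top).comp h
  rw [ENNReal.toReal_zero] at h0
  refine h0.congr' ?_
  filter_upwards [self_mem_nhdsWithin] with τ hτ
  have m1 := hw τ hτ.1
  have m2 := hw t ht
  rw [slope_def_module, toL2_eq m1, toL2_eq m2, toL2_eq hw', ← MemLp.toLp_sub,
    ← MemLp.toLp_const_smul, ← MemLp.toLp_sub, Lp.norm_toLp]
  rfl

/-- The energy `∫ u² + u_x²` of a solution is conserved; a solution that vanishes at one time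
vanishes at all times. -/
theorem IsSolution.ae_eq_zero {γ : ℝ} {g : ℝ → ℝ} (hg : ContDiff ℝ ∞ g) (hg0 : g 0 = 0)
    (hge : ∀ r : ℝ, γ * r ^ 2 ≤ g r) {s T : ℝ} (hs : 2 ≤ s) (hT : 0 < T) {u₀ : Plane → ℝ}
    {u : ℝ → Plane → ℝ} (hu : IsSolution γ g s T u₀ u) {t₀ : ℝ} (ht₀ : t₀ ∈ Set.Icc 0 T)
    (h0 : u t₀ =ᵐ[volume] 0) {t : ℝ} (ht : t ∈ Set.Icc 0 T) : u t =ᵐ[volume] 0 := by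
  obtain ⟨ut, v, hutc, hder, hsys⟩ := hu.system
  have hX := hu.contX.1
  have hs0 : 0 ≤ s := by linarith
  have hs2 : 0 ≤ s - 2 := by linarith
  have hx : ∀ τ, ∃ f, τ ∈ Set.Icc 0 T → HasFourierDeriv 0 (u τ) f := fun τ => by
    by_cases hτ : τ ∈ Set.Icc 0 T
    · obtain ⟨f, hf⟩ := (hX τ hτ).exists_hasFourierDeriv hs0
      exact ⟨f, fun _ => hf⟩
    · exact ⟨0, fun h => absurd h hτ⟩
  choose ux hux using hx
  set E : ℝ → ℝ := fun τ => ‖toL2 (u τ)‖ ^ 2 + ‖toL2 (ux τ)‖ ^ 2 with hE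
  have hEd : ∀ τ ∈ Set.Icc 0 T, HasDerivWithinAt E 0 (Set.Icc 0 T) τ := by
    intro τ hτ
    obtain ⟨utx, hutx⟩ := (hutc.1 τ hτ).exists_hasFourierDeriv hs2
    have q : ∀ σ ∈ Set.Icc 0 T, HasFourierDeriv 0 ((σ - τ)⁻¹ • (u σ - u τ) - ut τ)
        ((σ - τ)⁻¹ • (ux σ - ux τ) - utx) := fun σ hσ =>
      (((hux σ hσ).sub (hux τ hτ)).smul _).sub hutx
    have d1 : HasDerivWithinAt (fun σ => toL2 (u σ)) (toL2 (ut τ)) (Set.Icc 0 T) τ := by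
      refine hasDerivWithinAt_toL2 (fun σ hσ => (hX σ hσ).1) hτ hutx.1 ?_
      refine tendsto_of_tendsto_of_tendsto_of_le_of_le' tendsto_const_nhds (hder τ hτ)
        (Eventually.of_forall fun _ => zero_le) ?_
      filter_upwards [self_mem_nhdsWithin] with σ hσ
      rw [← eLpNorm_fourierL2 (q σ hσ.1).1]
      exact eLpNorm_fourierL2_le_xNorm hs2 _
    have d2 : HasDerivWithinAt (fun σ => toL2 (ux σ)) (toL2 utx) (Set.Icc 0 T) τ := by
      refine hasDerivWithinAt_toL2 (fun σ hσ => (hux σ hσ).2) hτ hutx.2 ?_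
      refine tendsto_of_tendsto_of_tendsto_of_le_of_le' tendsto_const_nhds (hder τ hτ)
        (Eventually.of_forall fun _ => zero_le) ?_
      filter_upwards [self_mem_nhdsWithin] with σ hσ
      rw [← eLpNorm_fourierL2 (q σ hσ.1).2, eLpNorm_congr_ae (q σ hσ.1).3]
      exact eLpNorm_symb_mul_le_xNorm hs2 _
    refine (d1.norm_sq.add d2.norm_sq).congr_deriv ?_
    rw [inner_toL2 (hX τ hτ).1 hutx.1, inner_toL2 (hux τ hτ).2 hutx.2, ← mul_add,
      (hsys τ hτ).integral_energy_eq_zero hg hg0 hge hs (hu.continuous_rep τ hτ) (hX τ hτ)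
        (hux τ hτ) hutx, mul_zero]
  have hconst : ∀ τ ∈ Set.Icc 0 T, E τ = E 0 :=
    constant_of_derivWithin_zero (fun τ hτ => (hEd τ hτ).differentiableWithinAt)
      fun τ hτ => (hEd τ (Set.Ico_subset_Icc_self hτ)).derivWithin
        (uniqueDiffOn_Icc hT τ (Set.Ico_subset_Icc_self hτ))
  have hE0 : E t₀ = 0 := by
    have a1 : toL2 (u t₀) = 0 := by
      rw [toL2_eq_zero_iff (hX t₀ ht₀).1]
      exact h0
    have hz : HasFourierDeriv 0 (0 : Plane → ℝ) 0 := by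
      simpa using (hux t₀ ht₀).sub (hux t₀ ht₀)
    have a2 : toL2 (ux t₀) = 0 := by
      rw [toL2_eq_zero_iff (hux t₀ ht₀).2]
      exact hz.ae_eq ((hux t₀ ht₀).isWeakDeriv.congr h0)
    simp [hE, a1, a2]
  have hEt : E t = 0 := by rw [hconst t ht, ← hconst t₀ ht₀, hE0]
  have hn : toL2 (u t) = 0 := by
    have h1 := sq_nonneg ‖toL2 (u t)‖
    have h2 := sq_nonneg ‖toL2 (ux t)‖
    simp only [hE] at hEt
    have h3 : ‖toL2 (u t)‖ ^ 2 = 0 := by linarith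
    simpa using h3
  exact (toL2_eq_zero_iff (hX t ht).1).1 hn

/-! ### The test functions of the strip argument -/

/-- A continuous function with exponential bounds near `±∞` has such a bound everywhere. -/
theorem exists_abs_le_exp {f : ℝ → ℝ} {c d : ℝ} (hf : Continuous f)
    (hc : ∀ x < c, |f x| ≤ Real.exp x) (hd : ∀ x, d < x → |f x| ≤ Real.exp (-x)) :
    ∃ C, ∀ x, |f x| ≤ C * Real.exp (-|x|) := by
  set R := max |c| |d|
  obtain ⟨C, hC⟩ := (isCompact_Icc (a := -R) (b := R)).exists_bound_of_continuousOn
    (f := fun x => f x * Real.exp |x|) (by fun_prop)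
  refine ⟨max C 1, fun x => ?_⟩
  -- On a compact interval by continuity, and with constant `1` outside it.
  have key : |f x| * Real.exp |x| ≤ max C 1 := by
    by_cases hx : x ∈ Set.Icc (-R) R
    · have := hC x hx
      rw [norm_mul, Real.norm_of_nonneg (Real.exp_pos _).le] at this
      exact this.trans (le_max_left _ _)
    · refine le_trans ?_ (le_max_right _ _)
      rw [Set.mem_Icc, not_and_or, not_le, not_le] at hx
      have h1 : |c| ≤ R := le_max_left _ _
      have h2 : |d| ≤ R := le_max_right _ _
      have h0 := (abs_nonneg c).trans h1
      rcases hx with hx | hx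
      · have hx' : |x| = -x := abs_of_neg (by linarith)
        have := mul_le_mul_of_nonneg_right (hc x (by linarith [neg_abs_le c]))
          (Real.exp_pos (-x)).le
        rwa [← Real.exp_add, add_neg_cancel, Real.exp_zero, ← hx'] at this
      · have hx' : |x| = x := abs_of_pos (by linarith)
        have := mul_le_mul_of_nonneg_right (hd x (by linarith [le_abs_self d])) (Real.exp_pos x).le
        rw [← Real.exp_add, neg_add_cancel, Real.exp_zero] at this
        rwa [hx']
  rw [Real.exp_neg, ← div_eq_mul_inv, le_div_iff₀ (Real.exp_pos _)]
  exact key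

/-- A smooth function which is `exp x` to the left and `-exp (-x)` to the right of `[c, d]`: outside
this interval it is increasing and solves `h = h''`. -/
theorem exists_profile {c d : ℝ} (hcd : c < d) : ∃ (h h₁ h₂ : ℝ → ℝ) (C : ℝ), ContDiff ℝ ∞ h ∧
    (∀ x, HasDerivAt h (h₁ x) x) ∧ (∀ x, HasDerivAt h₁ (h₂ x) x) ∧ Continuous h₂ ∧
    (∀ x, |h x| ≤ C * Real.exp (-|x|)) ∧ (∀ x, |h₁ x| ≤ C * Real.exp (-|x|)) ∧
    (∀ x, |h₂ x| ≤ C * Real.exp (-|x|)) ∧ ∀ x, x ∉ Set.Icc c d → h x = h₂ x ∧ 0 < h₁ x := by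
  set σ : ℝ → ℝ := fun x => Real.smoothTransition ((x - c) / (d - c)) with hσ
  have hσs : ContDiff ℝ ∞ σ := Real.smoothTransition.contDiff.comp (by fun_prop)
  set h : ℝ → ℝ := fun x => (1 - σ x) * Real.exp x - σ x * Real.exp (-x) with hh
  have hs : ContDiff ℝ ∞ h := by fun_prop
  have hs₁ : ContDiff ℝ ∞ (deriv h) := (contDiff_infty_iff_deriv.1 hs).2
  have hs₂ : ContDiff ℝ ∞ (deriv (deriv h)) := (contDiff_infty_iff_deriv.1 hs₁).2
  have hpos : 0 < d - c := sub_pos.2 hcd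
  have L0 : ∀ x < c, h =ᶠ[𝓝 x] Real.exp := fun x hx => by
    filter_upwards [Iio_mem_nhds hx] with z hz
    have : σ z = 0 := Real.smoothTransition.zero_of_nonpos
      (div_nonpos_of_nonpos_of_nonneg (sub_nonpos.2 (le_of_lt hz)) hpos.le)
    simp [hh, this]
  have L1 : ∀ x < c, deriv h =ᶠ[𝓝 x] Real.exp := fun x hx => by
    have := (L0 x hx).deriv
    rwa [Real.deriv_exp] at this
  have L2 : ∀ x < c, deriv (deriv h) x = Real.exp x := fun x hx => by
    have := (L1 x hx).deriv.eq_of_nhds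
    rwa [Real.deriv_exp] at this
  have dn : ∀ x : ℝ, HasDerivAt (fun x : ℝ => Real.exp (-x)) (-Real.exp (-x)) x := fun x => by
    simpa using (hasDerivAt_neg x).exp
  have R0 : ∀ x, d < x → h =ᶠ[𝓝 x] fun x => -Real.exp (-x) := fun x hx => by
    filter_upwards [Ioi_mem_nhds hx] with z hz
    have : σ z = 1 := Real.smoothTransition.one_of_one_le
      ((one_le_div hpos).2 (by linarith [Set.mem_Ioi.1 hz]))
    simp [hh, this]
  have R1 : ∀ x, d < x → deriv h =ᶠ[𝓝 x] fun x => Real.exp (-x) := fun x hx => by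
    refine (R0 x hx).deriv.trans (Eventually.of_forall fun z => ?_)
    simpa using (dn z).neg.deriv
  have R2 : ∀ x, d < x → deriv (deriv h) x = -Real.exp (-x) := fun x hx => by
    rw [(R1 x hx).deriv.eq_of_nhds]
    exact (dn x).deriv
  obtain ⟨C, hC⟩ := exists_abs_le_exp (c := c) (d := d) hs.continuous
    (fun x hx => by rw [(L0 x hx).eq_of_nhds, abs_of_pos (Real.exp_pos _)])
    (fun x hx => by rw [(R0 x hx).eq_of_nhds, abs_neg, abs_of_pos (Real.exp_pos _)])
  obtain ⟨C₁, hC₁⟩ := exists_abs_le_exp (c := c) (d := d) hs₁.continuous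
    (fun x hx => by rw [(L1 x hx).eq_of_nhds, abs_of_pos (Real.exp_pos _)])
    (fun x hx => by rw [(R1 x hx).eq_of_nhds, abs_of_pos (Real.exp_pos _)])
  obtain ⟨C₂, hC₂⟩ := exists_abs_le_exp (c := c) (d := d) hs₂.continuous
    (fun x hx => by rw [L2 x hx, abs_of_pos (Real.exp_pos _)])
    (fun x hx => by rw [R2 x hx, abs_neg, abs_of_pos (Real.exp_pos _)])
  have up : ∀ {A B x : ℝ}, A ≤ B → A * Real.exp (-|x|) ≤ B * Real.exp (-|x|) := fun hAB =>
    mul_le_mul_of_nonneg_right hAB (Real.exp_pos _).le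
  refine ⟨h, deriv h, deriv (deriv h), max C (max C₁ C₂), hs,
    fun x => (hs.differentiable (by simp) x).hasDerivAt,
    fun x => (hs₁.differentiable (by simp) x).hasDerivAt, hs₂.continuous,
    fun x => (hC x).trans (up (le_max_left _ _)),
    fun x => (hC₁ x).trans (up ((le_max_left _ _).trans (le_max_right _ _))),
    fun x => (hC₂ x).trans (up ((le_max_right _ _).trans (le_max_right _ _))), fun x hx => ?_⟩
  rw [Set.mem_Icc, not_and_or, not_le, not_le] at hx
  rcases hx with hx | hx
  · rw [L2 x hx, (L0 x hx).eq_of_nhds, (L1 x hx).eq_of_nhds]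
    exact ⟨rfl, Real.exp_pos _⟩
  · rw [R2 x hx, (R0 x hx).eq_of_nhds, (R1 x hx).eq_of_nhds]
    exact ⟨rfl, Real.exp_pos _⟩

/-- The cutoff `(1 + y² / (n + 1))⁻¹` in the vertical direction. -/
def cutY (n : ℕ) (y : ℝ) : ℝ := (1 + y ^ 2 / (n + 1))⁻¹

/-- The derivative of the cutoff `cutY n`. -/
def cutY' (n : ℕ) (y : ℝ) : ℝ := -(2 * y / (n + 1)) / (1 + y ^ 2 / (n + 1)) ^ 2

theorem one_le_cutY_denom (n : ℕ) (y : ℝ) : 1 ≤ 1 + y ^ 2 / ((n : ℝ) + 1) := by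
  have : 0 ≤ y ^ 2 / ((n : ℝ) + 1) := by positivity
  linarith

theorem contDiff_cutY (n : ℕ) : ContDiff ℝ ∞ (cutY n) := by
  unfold cutY
  refine ContDiff.inv (by fun_prop) fun y => ?_
  linarith [one_le_cutY_denom n y]

theorem hasDerivAt_cutY (n : ℕ) (y : ℝ) : HasDerivAt (cutY n) (cutY' n y) y := by
  have h1 : HasDerivAt (fun y : ℝ => 1 + y ^ 2 / ((n : ℝ) + 1)) (2 * y / (n + 1)) y := by
    simpa using ((hasDerivAt_pow 2 y).div_const ((n : ℝ) + 1)).const_add 1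
  exact h1.fun_inv (by linarith [one_le_cutY_denom n y])

theorem continuous_cutY' (n : ℕ) : Continuous (cutY' n) := by
  unfold cutY'
  refine Continuous.div (by fun_prop) (by fun_prop) fun y => ?_
  have := one_le_cutY_denom n y
  positivity

theorem cutY_nonneg (n : ℕ) (y : ℝ) : 0 ≤ cutY n y := by
  unfold cutY
  positivity

theorem cutY_le_one (n : ℕ) (y : ℝ) : cutY n y ≤ 1 :=
  inv_le_one_of_one_le₀ (one_le_cutY_denom n y)

theorem cutY_le (n : ℕ) (y : ℝ) : cutY n y ≤ 2 * (n + 1) * (1 + |y|)⁻¹ := by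
  have hn : (0 : ℝ) ≤ n := n.cast_nonneg
  have h1 : 0 < 1 + y ^ 2 / ((n : ℝ) + 1) := by positivity
  have h2 : 0 < 1 + |y| := by positivity
  unfold cutY
  rw [inv_le_comm₀ h1 (by positivity), mul_inv, inv_inv, inv_mul_eq_div,
    div_le_iff₀ (by positivity)]
  have h3 : (1 + y ^ 2 / ((n : ℝ) + 1)) * (2 * (n + 1)) = 2 * (n + 1) + 2 * y ^ 2 := by
    field_simp
  rw [h3, ← sq_abs y]
  nlinarith [sq_nonneg (|y| - 1), sq_nonneg |y|]

/-- A bound uniform in `n` by a square integrable function of `y`. -/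
theorem abs_cutY'_le (n : ℕ) (y : ℝ) : |cutY' n y| ≤ 3 * (1 + |y|)⁻¹ := by
  have hn : (0 : ℝ) ≤ n := n.cast_nonneg
  have hN : (0 : ℝ) < (n : ℝ) + 1 := by positivity
  have h2 : 0 < 1 + |y| := by positivity
  have h1 : 0 < (1 + y ^ 2 / ((n : ℝ) + 1)) ^ 2 := by positivity
  unfold cutY'
  rw [abs_div, abs_neg, abs_div, abs_of_pos hN, abs_of_pos h1, abs_mul, abs_two,
    ← div_eq_mul_inv, div_le_div_iff₀ h1 h2]
  have h3 : 1 / ((n : ℝ) + 1) * (1 + y ^ 2) ≤ (1 + y ^ 2 / ((n : ℝ) + 1)) ^ 2 := by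
    have h4 : 1 / ((n : ℝ) + 1) ≤ 1 := by
      rw [div_le_one hN]
      linarith
    have h5 : 0 ≤ y ^ 2 / ((n : ℝ) + 1) := by positivity
    calc 1 / ((n : ℝ) + 1) * (1 + y ^ 2) = 1 / ((n : ℝ) + 1) + y ^ 2 / ((n : ℝ) + 1) := by ring
      _ ≤ _ := by nlinarith
  have h6 : 2 * |y| * (1 + |y|) ≤ 3 * (1 + y ^ 2) := by
    rw [← sq_abs y]
    nlinarith [sq_nonneg (|y| - 1)]
  calc 2 * |y| / ((n : ℝ) + 1) * (1 + |y|) = 1 / ((n : ℝ) + 1) * (2 * |y| * (1 + |y|)) := by ring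
    _ ≤ 1 / ((n : ℝ) + 1) * (3 * (1 + y ^ 2)) := mul_le_mul_of_nonneg_left h6 (by positivity)
    _ ≤ _ := by linarith

theorem tendsto_div_natCast_add_one (c : ℝ) :
    Tendsto (fun n : ℕ => c / ((n : ℝ) + 1)) atTop (𝓝 0) :=
  tendsto_const_nhds.div_atTop
    (tendsto_atTop_add_const_right _ _ tendsto_natCast_atTop_atTop)

theorem tendsto_cutY (y : ℝ) : Tendsto (fun n => cutY n y) atTop (𝓝 1) := by
  have := ((tendsto_div_natCast_add_one (y ^ 2)).const_add 1).inv₀ (by norm_num)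
  simpa [cutY] using this

theorem tendsto_cutY' (y : ℝ) : Tendsto (fun n => cutY' n y) atTop (𝓝 0) := by
  have h1 := ((tendsto_div_natCast_add_one (y ^ 2)).const_add 1).pow 2
  have := (tendsto_div_natCast_add_one (2 * y)).neg.div h1 (by norm_num)
  rw [show -(0 : ℝ) / (1 + 0) ^ 2 = 0 by norm_num] at this
  exact this

/-- A square integrable majorant for the test functions. -/
theorem memLp_majorant :
    MemLp (fun p : Plane => Real.exp (-|p 0|) * (1 + |p 1|)⁻¹) 2 volume := by
  have hy : Continuous fun y : ℝ => (1 + |y|)⁻¹ :=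
    Continuous.inv₀ (by fun_prop) fun y => by positivity
  have hcont : Continuous fun p : Plane => Real.exp (-|p 0|) * (1 + |p 1|)⁻¹ :=
    (by fun_prop : Continuous fun p : Plane => Real.exp (-|p 0|)).mul
      (hy.comp (by fun_prop : Continuous fun p : Plane => p 1))
  rw [memLp_two_iff_integrable_sq hcont.aestronglyMeasurable,
    ← measurePreserving_ofYX.integrable_comp_emb measurableEmbedding_ofYX]
  have i1 : Integrable (fun x : ℝ => Real.exp (-|x|) ^ 2) volume := by
    refine (integrable_G.const_mul 2).mono' (by fun_prop) (Eventually.of_forall fun x => ?_)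
    have h1 : Real.exp (-|x|) ≤ 1 := Real.exp_le_one_iff.2 (by simp)
    have h2 := Real.exp_pos (-|x|)
    rw [Real.norm_of_nonneg (by positivity)]
    unfold G
    nlinarith
  have i2 : Integrable (fun y : ℝ => (1 + |y|)⁻¹ ^ 2) volume := by
    refine integrable_inv_one_add_sq.mono' (hy.pow 2).aestronglyMeasurable
      (Eventually.of_forall fun y => ?_)
    rw [Real.norm_of_nonneg (by positivity), inv_pow]
    refine inv_anti₀ (by positivity) ?_
    rw [← sq_abs y]
    nlinarith [abs_nonneg y]
  refine (i2.mul_prod i1).congr (Eventually.of_forall fun q => ?_)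
  change (1 + |q.1|)⁻¹ ^ 2 * Real.exp (-|q.2|) ^ 2 = (Real.exp (-|q.2|) * (1 + |q.1|)⁻¹) ^ 2
  ring

/-! ### A strip of zeros forces a time slice to vanish -/

theorem memLp_of_le_majorant {f : Plane → ℝ} {C : ℝ} (hf : Continuous f)
    (hC : ∀ p, |f p| ≤ C * (Real.exp (-|p 0|) * (1 + |p 1|)⁻¹)) : MemLp f 2 volume := by
  refine MemLp.of_le_mul (c := C) memLp_majorant hf.aestronglyMeasurable
    (Eventually.of_forall fun p => ?_)
  rw [Real.norm_of_nonneg (by positivity : 0 ≤ Real.exp (-|p 0|) * (1 + |p 1|)⁻¹)]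
  exact hC p

theorem hasFDerivAt_coord (i : Fin 2) (p : Plane) :
    HasFDerivAt (fun p : Plane => p i) (EuclideanSpace.proj i : Plane →L[ℝ] ℝ) p :=
  (EuclideanSpace.proj i : Plane →L[ℝ] ℝ).hasFDerivAt

theorem fderiv_mul_coord {h h₁ χ χ₁ : ℝ → ℝ} (hh : ∀ x, HasDerivAt h (h₁ x) x)
    (hχ : ∀ y, HasDerivAt χ (χ₁ y) y) (p v : Plane) :
    fderiv ℝ (fun p : Plane => h (p 0) * χ (p 1)) p v =
      h₁ (p 0) * χ (p 1) * v 0 + h (p 0) * χ₁ (p 1) * v 1 := by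
  have d0 := (hh (p 0)).comp_hasFDerivAt p (hasFDerivAt_coord 0 p)
  have d1 := (hχ (p 1)).comp_hasFDerivAt p (hasFDerivAt_coord 1 p)
  have := (d0.mul d1).fderiv
  rw [show (fun p : Plane => h (p 0) * χ (p 1)) =
    (h ∘ fun p : Plane => p 0) * (χ ∘ fun p : Plane => p 1) from rfl, this]
  simp
  ring

/-- If a time slice vanishes on a vertical strip together with its time derivative, it vanishes
identically. With `F` the flux, testing `G * (F_x + v_y) = 0` on the strip with
`(h - h'') ⊗ cutY n` gives `∫ F h' cutY n + ∫ v h (cutY n)' = 0`, and then `∫ F h' = 0` in the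
limit. As `F ≥ 0` vanishes on the strip and `h' > 0` outside it, `F` vanishes. -/
theorem SystemAt.ae_eq_zero_of_strip {γ : ℝ} (hγ : 0 < γ) {g : ℝ → ℝ} (hg : ContDiff ℝ ∞ g)
    (hg0 : g 0 = 0) (hge : ∀ r : ℝ, γ * r ^ 2 ≤ g r) (hgt : ∀ r : ℝ, r ≠ 0 → γ * r ^ 2 < g r)
    {s : ℝ} (hs : 2 ≤ s) {u ut v : Plane → ℝ} (hu : Continuous u) (hX : MemX s u)
    (hut : MemLp ut 2 volume) (h : SystemAt γ g u ut v) {a b : ℝ} (hab : a < b)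
    (hua : ∀ p : Plane, p 0 ∈ Set.Ioo a b → u p = 0)
    (huta : ∀ᵐ p : Plane, p 0 ∈ Set.Ioo a b → ut p = 0) : u =ᵐ[volume] 0 := by
  obtain ⟨w, -, uy, M, h1, -, h3, hwc, hd, hM, hM'⟩ := hX.regularity hs hu
  obtain ⟨vy, Fx, hv0, hv1, hv1', hF, hF', hFi, hK, hKeq⟩ :=
    h.exists_data hg hg0 hge hu hwc hM hM' h1 h3 hut
  obtain ⟨c, hac, hcb⟩ := exists_between hab
  obtain ⟨d, hcd, hdb⟩ := exists_between hcb
  obtain ⟨η, η₁, η₂, C, hη, dη, dη₁, cη₂, bη, bη₁, bη₂, hout⟩ := exists_profile hcd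
  have cη : Continuous η := hη.continuous
  have cη₁ : Continuous η₁ := continuous_iff_continuousAt.2 fun x => (dη₁ x).continuousAt
  have hsub : ∀ x, x ∉ Set.Ioo a b → x ∉ Set.Icc c d := fun x hx hx' =>
    hx ⟨hac.trans_le hx'.1, hx'.2.trans_lt hdb⟩
  have hC0 : 0 ≤ C := by
    have := (abs_nonneg _).trans (bη 0)
    simpa using this
  have hbd : ∀ {f : ℝ → ℝ}, (∀ x, |f x| ≤ C * Real.exp (-|x|)) → ∀ x, |f x| ≤ C := fun hf x =>
    (hf x).trans (mul_le_of_le_one_right hC0 (Real.exp_le_one_iff.2 (by simp)))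
  have c0 : Continuous fun p : Plane => p 0 := by fun_prop
  have c1 : Continuous fun p : Plane => p 1 := by fun_prop
  have cX : ∀ n, Continuous (cutY n) := fun n => (contDiff_cutY n).continuous
  -- A product of a profile and a cutoff lies in `L²` and is bounded.
  have mX : ∀ (n : ℕ) {f : ℝ → ℝ}, Continuous f → (∀ x, |f x| ≤ C * Real.exp (-|x|)) →
      MemLp (fun p : Plane => f (p 0) * cutY n (p 1)) 2 volume := by
    intro n f hf hb
    refine memLp_of_le_majorant (C := C * (2 * (n + 1)))
      ((hf.comp c0).mul ((cX n).comp c1)) fun p => ?_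
    rw [abs_mul, abs_of_nonneg (cutY_nonneg n _)]
    calc _ ≤ C * Real.exp (-|p 0|) * (2 * (n + 1) * (1 + |p 1|)⁻¹) :=
          mul_le_mul (hb _) (cutY_le n _) (cutY_nonneg n _) (by positivity)
      _ = _ := by ring
  have bX : ∀ (n : ℕ) {f : ℝ → ℝ}, (∀ x, |f x| ≤ C * Real.exp (-|x|)) →
      ∀ p : Plane, |f (p 0) * cutY n (p 1)| ≤ C := by
    intro n f hb p
    rw [abs_mul, abs_of_nonneg (cutY_nonneg n _)]
    exact (mul_le_of_le_one_right (abs_nonneg _) (cutY_le_one n _)).trans (hbd hb _)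
  have bX' : ∀ (n : ℕ) (p : Plane), |η (p 0) * cutY' n (p 1)| ≤
      C * 3 * (Real.exp (-|p 0|) * (1 + |p 1|)⁻¹) := by
    intro n p
    rw [abs_mul]
    calc _ ≤ C * Real.exp (-|p 0|) * (3 * (1 + |p 1|)⁻¹) :=
          mul_le_mul (bη _) (abs_cutY'_le n _) (abs_nonneg _) (by positivity)
      _ = _ := by ring
  have mX' : ∀ n, MemLp (fun p : Plane => η (p 0) * cutY' n (p 1)) 2 volume := fun n =>
    memLp_of_le_majorant ((cη.comp c0).mul ((continuous_cutY' n).comp c1)) (bX' n)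
  have hwa : ∀ p : Plane, p 0 ∈ Set.Ioo a b → w p = 0 := by
    intro p hp
    have e1 : (fun x : ℝ => u !₂[x, p 1]) =ᶠ[𝓝 (p 0)] fun _ => 0 := by
      filter_upwards [isOpen_Ioo.mem_nhds hp] with x hx
      exact hua _ (by simpa using hx)
    have e2 := (hd (p 0) (p 1)).unique ((hasDerivAt_const (p 0) (0 : ℝ)).congr_of_eventuallyEq e1)
    rwa [show !₂[p 0, p 1] = p by ext i; fin_cases i <;> rfl] at e2
  have hK0 : ∀ᵐ p : Plane, p 0 ∈ Set.Ioo a b → -(ut p + γ * (u p * w p)) = 0 := by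
    filter_upwards [huta] with p hp hpa
    rw [hp hpa, hua p hpa]
    ring
  -- `K - K_xx = F_x + v_y` is tested with `η ⊗ cutY n`; the left side vanishes, since `K = 0` on
  -- the strip and `η = η''` outside it.
  have key : ∀ n, (∫ p, flux γ g u w p * (η₁ (p 0) * cutY n (p 1))) +
      ∫ p, v p * (η (p 0) * cutY' n (p 1)) = 0 := by
    intro n
    have hcut : ContDiff ℝ ∞ fun p : Plane => η (p 0) * cutY n (p 1) :=
      (hη.comp (by fun_prop)).mul ((contDiff_cutY n).comp (by fun_prop))
    have f0 : (fun p : Plane => fderiv ℝ (fun p : Plane => η (p 0) * cutY n (p 1)) p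
        (EuclideanSpace.single 0 (1 : ℝ))) = fun p => η₁ (p 0) * cutY n (p 1) := by
      ext p
      rw [fderiv_mul_coord dη (hasDerivAt_cutY n)]
      simp
    have f1 : (fun p : Plane => fderiv ℝ (fun p : Plane => η (p 0) * cutY n (p 1)) p
        (EuclideanSpace.single 1 (1 : ℝ))) = fun p => η (p 0) * cutY' n (p 1) := by
      ext p
      rw [fderiv_mul_coord dη (hasDerivAt_cutY n)]
      simp
    have g0 := hF'.integral_mul_of_memLp hF.1 hF.2 hcut (mX n cη bη)
      (by rw [f0]; exact mX n cη₁ bη₁)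
    have g1 := hv1'.integral_mul_of_memLp hv1.1 hv1.2 hcut (mX n cη bη) (by rw [f1]; exact mX' n)
    simp only [congrFun f0] at g0
    simp only [congrFun f1] at g1
    have g2 := integral_mul_sub_of_convG (hF.2.add hv1.2) hK.neg hKeq (mX n cη bη)
      (mX n cη₂ bη₂) (φ₁ := fun p => η₁ (p 0) * cutY n (p 1))
      (fun x y => by simpa using (dη x).mul_const (cutY n y))
      (fun x y => by simpa using (dη₁ x).mul_const (cutY n y))
      ((cη₂.comp c0).mul ((cX n).comp c1))
      ⟨C, fun p => ⟨bX n bη p, bX n bη₁ p, bX n bη₂ p⟩⟩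
    have g3 : ∫ p : Plane, (-fun p => ut p + γ * (u p * w p)) p *
        (η (p 0) * cutY n (p 1) - η₂ (p 0) * cutY n (p 1)) = 0 := by
      refine integral_eq_zero_of_ae ?_
      filter_upwards [hK0] with p hp
      by_cases hpa : p 0 ∈ Set.Ioo a b
      · rw [Pi.neg_apply, hp hpa, zero_mul, Pi.zero_apply]
      · rw [(hout _ (hsub _ hpa)).1, sub_self, mul_zero, Pi.zero_apply]
    have g4 : ∫ p, (Fx + vy) p * (η (p 0) * cutY n (p 1)) =
        (∫ p, Fx p * (η (p 0) * cutY n (p 1))) + ∫ p, vy p * (η (p 0) * cutY n (p 1)) := by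
      simp only [Pi.add_apply, add_mul]
      exact integral_add (integrable_mul_of_memLp hF.2 (mX n cη bη))
        (integrable_mul_of_memLp hv1.2 (mX n cη bη))
    rw [g3, g4] at g2
    linarith
  have hFc : Continuous (flux γ g u w) := by
    have := hg.continuous
    unfold flux
    fun_prop
  have t1 : Tendsto (fun n => ∫ p, flux γ g u w p * (η₁ (p 0) * cutY n (p 1))) atTop
      (𝓝 (∫ p, flux γ g u w p * η₁ (p 0))) := by
    refine tendsto_integral_of_dominated_convergence (fun p => |flux γ g u w p| * C) (fun n => ?_)
      (hFi.abs.mul_const C) (fun n => Eventually.of_forall fun p => ?_)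
      (Eventually.of_forall fun p => ?_)
    · exact (hFc.mul ((cη₁.comp c0).mul ((cX n).comp c1))).aestronglyMeasurable
    · rw [norm_mul]
      exact mul_le_mul_of_nonneg_left (bX n bη₁ p) (abs_nonneg _)
    · simpa using ((tendsto_cutY (p 1)).const_mul (η₁ (p 0))).const_mul (flux γ g u w p)
  have t2 : Tendsto (fun n => ∫ p, v p * (η (p 0) * cutY' n (p 1))) atTop (𝓝 (∫ _ : Plane, 0)) := by
    refine tendsto_integral_of_dominated_convergence
      (fun p => |v p * (C * 3 * (Real.exp (-|p 0|) * (1 + |p 1|)⁻¹))|)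
      (fun n => (integrable_mul_of_memLp hv1.1 (mX' n)).1)
      (integrable_mul_of_memLp hv1.1 (memLp_majorant.const_mul (C * 3))).abs
      (fun n => Eventually.of_forall fun p => ?_) (Eventually.of_forall fun p => ?_)
    · rw [norm_mul, abs_mul]
      exact mul_le_mul_of_nonneg_left ((bX' n p).trans (le_abs_self _)) (abs_nonneg _)
    · simpa using ((tendsto_cutY' (p 1)).const_mul (η (p 0))).const_mul (v p)
  have hlim : ∫ p, flux γ g u w p * η₁ (p 0) = 0 := by
    have t3 := t1.add t2
    simp_rw [key] at t3
    simpa using (tendsto_nhds_unique tendsto_const_nhds t3).symm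
  have hFp : ∀ p, flux γ g u w p = 1 / 2 * (g (u p) - γ * u p ^ 2) + γ / 2 * w p ^ 2 := fun p => by
    unfold flux
    ring
  have hnn : ∀ p : Plane, 0 ≤ flux γ g u w p * η₁ (p 0) := by
    intro p
    by_cases hpa : p 0 ∈ Set.Ioo a b
    · rw [hFp, hua p hpa, hwa p hpa, hg0]
      simp
    · refine mul_nonneg ?_ (hout _ (hsub _ hpa)).2.le
      rw [hFp]
      have := sub_nonneg.2 (hge (u p))
      positivity
  have hint : Integrable (fun p : Plane => flux γ g u w p * η₁ (p 0)) volume :=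
    hFi.mul_bdd (cη₁.comp c0).aestronglyMeasurable (Eventually.of_forall fun p => hbd bη₁ (p 0))
  have hzero := (integral_eq_zero_iff_of_nonneg hnn hint).1 hlim
  filter_upwards [hzero] with p hp
  by_cases hpa : p 0 ∈ Set.Ioo a b
  · exact hua p hpa
  · by_contra hne
    have h4 := hgt (u p) hne
    have h5 : 0 < flux γ g u w p := by
      rw [hFp]
      have := sub_pos.2 h4
      positivity
    exact (mul_pos h5 (hout _ (hsub _ hpa)).2).ne' hp

/-- If a solution vanishes on a strip at all times near `t`, so does its time derivative at `t`. -/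
theorem HasTimeDerivX.ae_eq_zero_of_strip {s T : ℝ} (hs : 0 ≤ s) (hT : 0 < T)
    {u ut : ℝ → Plane → ℝ} (hu : ∀ t ∈ Set.Icc 0 T, MemLp (u t) 2 volume) {t : ℝ}
    (ht : t ∈ Set.Icc 0 T) (hut : MemLp (ut t) 2 volume) (h : HasTimeDerivX s T u ut)
    {S : Set Plane} (hS : MeasurableSet S)
    (h0 : ∀ᶠ τ in 𝓝[Set.Icc 0 T] t, ∀ p ∈ S, u τ p = 0) : ∀ᵐ p : Plane, p ∈ S → ut t p = 0 := by
  -- This uses `0 < T`: on a degenerate interval every function would be a time derivative.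
  have hne : (𝓝[Set.Icc 0 T \ {t}] t).NeBot := by
    have := uniqueDiffWithinAt_iff_accPt.1 (uniqueDiffOn_Icc hT t ht)
    rwa [accPt_principal_iff_nhdsWithin] at this
  have ht0 : ∀ p ∈ S, u t p = 0 := h0.self_of_nhdsWithin ht
  -- The difference quotients vanish on `S`, so `ut t` is there, up to its sign, the full error.
  have hle : ∀ᶠ τ in 𝓝[Set.Icc 0 T \ {t}] t,
      eLpNorm (ut t) 2 (volume.restrict S) ≤ xNorm s ((τ - t)⁻¹ • (u τ - u t) - ut t) := by
    filter_upwards [nhdsWithin_mono t Set.sdiff_subset h0, self_mem_nhdsWithin] with τ hτ hτ'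
    have hm : MemLp ((τ - t)⁻¹ • (u τ - u t) - ut t) 2 volume :=
      (((hu τ hτ'.1).sub (hu t ht)).const_smul _).sub hut
    calc eLpNorm (ut t) 2 (volume.restrict S)
        = eLpNorm ((τ - t)⁻¹ • (u τ - u t) - ut t) 2 (volume.restrict S) := by
          refine eLpNorm_congr_norm_ae
            ((ae_restrict_iff' hS).2 (Eventually.of_forall fun p hp => ?_))
          simp [hτ p hp, ht0 p hp]
      _ ≤ eLpNorm ((τ - t)⁻¹ • (u τ - u t) - ut t) 2 volume :=
          eLpNorm_mono_measure _ Measure.restrict_le_self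
      _ ≤ _ := by
          rw [← eLpNorm_fourierL2 hm]
          exact eLpNorm_fourierL2_le_xNorm hs _
  have hz : eLpNorm (ut t) 2 (volume.restrict S) = 0 :=
    le_antisymm (ge_of_tendsto (h t ht) hle) zero_le
  rw [eLpNorm_eq_zero_iff hut.1.restrict (by norm_num)] at hz
  exact (ae_restrict_iff' hS).1 hz

end CHKP

end

theorem theorem5p1 (γ : ℝ) (hγ : 0 < γ) (g : ℝ → ℝ) (hg : ContDiff ℝ ∞ g) (hg0 : g 0 = 0)
    (hge : ∀ r : ℝ, γ * r ^ 2 ≤ g r) (hgt : ∀ r : ℝ, r ≠ 0 → γ * r ^ 2 < g r)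
    (s : ℝ) (hs : 2 ≤ s) (T : ℝ) (hT : 0 < T)
    (u₀ : CHKP.Plane → ℝ) (u : ℝ → CHKP.Plane → ℝ) (hu : CHKP.IsSolution γ g s T u₀ u)
    (hnontriv : ∃ t ∈ Set.Icc 0 T, ∃ p : CHKP.Plane, u t p ≠ 0) :
    ¬ ∃ W : Set (ℝ × ℝ), W.Nonempty ∧
      (∃ O : Set (ℝ × ℝ), IsOpen O ∧ W = O ∩ (Set.Icc 0 T ×ˢ Set.univ)) ∧
      ∀ t x : ℝ, (t, x) ∈ W → ∀ y : ℝ, u t !₂[x, y] = 0 := by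
  rintro ⟨W, ⟨⟨t₀, x₀⟩, hW⟩, ⟨O, hO, rfl⟩, hzero⟩
  have ht₀ : t₀ ∈ Set.Icc 0 T := hW.2.1
  obtain ⟨U, V, hU, hV, htU, hxV, hUV⟩ := isOpen_prod_iff.1 hO t₀ x₀ hW.1
  obtain ⟨a, b, hx₀, hab⟩ := mem_nhds_iff_exists_Ioo_subset.1 (hV.mem_nhds hxV)
  have hstrip : ∀ t ∈ Set.Icc 0 T, t ∈ U → ∀ p : CHKP.Plane, p 0 ∈ Set.Ioo a b → u t p = 0 := by
    intro t ht htU p hp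
    have := hzero t (p 0) ⟨hUV ⟨htU, hab hp⟩, ht, Set.mem_univ _⟩ (p 1)
    rwa [show !₂[p 0, p 1] = p by ext i; fin_cases i <;> rfl] at this
  obtain ⟨ut, v, hut, hder, hsys⟩ := hu.system
  have hut0 := hder.ae_eq_zero_of_strip (by linarith) hT (fun t ht => (hu.contX.1 t ht).1) ht₀
    (hut.1 t₀ ht₀).1 (S := {p | p 0 ∈ Set.Ioo a b})
    ((by fun_prop : Measurable fun p : CHKP.Plane => p 0) measurableSet_Ioo) (by
      filter_upwards [self_mem_nhdsWithin, mem_nhdsWithin_of_mem_nhds (hU.mem_nhds htU)]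
        with t h1 h2
      exact hstrip t h1 h2)
  have h0 := (hsys t₀ ht₀).ae_eq_zero_of_strip hγ hg hg0 hge hgt hs (hu.continuous_rep t₀ ht₀)
    (hu.contX.1 t₀ ht₀) (hut.1 t₀ ht₀).1 (hx₀.1.trans hx₀.2) (hstrip t₀ ht₀ htU) hut0
  obtain ⟨t, ht, p, hp⟩ := hnontriv
  have h1 := hu.ae_eq_zero hg hg0 hge hs hT ht₀ h0 ht
  have h2 := (Continuous.ae_eq_iff_eq volume (hu.continuous_rep t ht) continuous_zero).1 h1
  exact hp (congrFun h2 p)
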